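/- Let $f:\mathbb{R}\to\mathbb{R}$ be a $2\pi$-periodic function of bounded variation (on a period) whose derivative is also of bounded variation, in the sense that $f$ is differentiable outside a countable set $C$ and $f'$ has bounded variation on $[0,2\pi]\setminus C$. Let $J(x)=f(x+0)-f(x-0)$ and $L=\{x\in(0,2\pi): J(x)\neq 0\}$; assume that $J(0)=J(\pi)=J(2\pi)=0$ and that every point of $L$ is a rational multiple of $2\pi$. Let $$c_\nu=\frac1{2\pi}\int_0^{2\pi}f(x)e^{-i\nu x}\,dx,\qquad \tilde S_n(x;f)=-i\sum_{\nu=-n}^{n}\operatorname{sign}(\nu)\,c_\nu e^{i\nu x},\qquad G(n)=\sum_{i=0}^n|c_i|,$$ $$Y_n(x)=-\frac1{\log(n)\,G(n)}\sum_{k=1}^n\tilde S_k(x;f)\,|c_k|$$ (with $Y_n=0$ if $\log(n)\,G(n)=0$). **Lemma 2.2.** There is an absolute constant $K>0$ such that, for every such $f$ and every interval $(a,b)\subseteq(0,2\pi)$, $a<b$, neither of whose endpoints is a jump point of $f$ (that is, $J(a)=J(b)=0$), the sum $\sum_{x\in L\cap(a,b)}|J(x)|$ converges and $$\lim_{n\to\infty}V_a^b(Y_n)=K\,\frac1\pi\sum_{x\in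 L\cap(a,b)}|J(x)|,$$ where $V_a^b(Y_n)$ is the total variation of $Y_n$ on $(a,b)$. -/

import Mathlib

open scoped Topology

/-- The jump `J(x) = f(x+0) - f(x-0)` of a function at a point. -/
noncomputable def jump (f : ℝ → ℝ) (x : ℝ) : ℝ :=
  Function.rightLim f x - Function.leftLim f x

/-- The set `L` of the points of `(0, 2π)` at which `f` has a nonzero jump. -/
def jumpSet (f : ℝ → ℝ) : Set ℝ :=
  {x | x ∈ Set.Ioo 0 (2 * Real.pi) ∧ jump f x ≠ 0}

/-- The derivative of `f` is of bounded variation (on a period): outside a countable set (which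
contains the jumps of `f`, and may contain corners) `f` is differentiable, and the derivative has
bounded variation on the part of the period where it is thus defined. -/
def HasBVDeriv (f : ℝ → ℝ) : Prop :=
  ∃ C : Set ℝ, C.Countable ∧ (∀ x, x ∉ C → DifferentiableAt ℝ f x) ∧
    BoundedVariationOn (deriv f) (Set.Icc 0 (2 * Real.pi) \ C)

/-- The Fourier coefficients `c_ν` of `f` on `[0, 2π]`, with the factor `1 / (2π)`. -/
noncomputable def coeff (f : ℝ → ℝ) (ν : ℤ) : ℂ :=
  fourierCoeffOn Real.two_pi_pos (fun x => (f x : ℂ)) ν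

theorem coeff_eq_integral (f : ℝ → ℝ) (ν : ℤ) :
    coeff f ν = 1 / (2 * Real.pi) *
      ∫ x in (0 : ℝ)..(2 * Real.pi), (f x : ℂ) * Complex.exp (-(Complex.I * ν * x)) := by
  have h2 : (Real.pi : ℂ) ≠ 0 := by exact_mod_cast Real.pi_ne_zero
  rw [coeff, fourierCoeffOn_eq_integral]
  simp only [sub_zero, Complex.real_smul, smul_eq_mul]
  push_cast
  congr 1
  refine intervalIntegral.integral_congr fun x _ => ?_
  simp only [fourier_coe_apply]
  rw [mul_comm]
  congr 2
  push_cast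
  field_simp
  ring

/-- The conjugate partial sum `-i ∑_{|ν| ≤ n} sign(ν) c_ν e^{iνx}`. -/
noncomputable def conjPartialSum (f : ℝ → ℝ) (n : ℕ) (x : ℝ) : ℂ :=
  -Complex.I * ∑ ν ∈ Finset.Icc (-(n : ℤ)) n,
    (ν.sign : ℂ) * coeff f ν * Complex.exp (Complex.I * ν * x)

/-- `G(n) = ∑_{i=0}^n |c_i|`. -/
noncomputable def coeffSum (f : ℝ → ℝ) (n : ℕ) : ℝ :=
  ∑ i ∈ Finset.range (n + 1), ‖coeff f i‖

/-- `Y_n(x) = -1 / (log(n) G(n)) ∑_{k=1}^n S̃_k(x; f) |c_k|`. Its values are real numbers, seen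
as elements of `ℂ`. -/
noncomputable def Yseq (f : ℝ → ℝ) (n : ℕ) (x : ℝ) : ℂ :=
  -(1 / ((Real.log n * coeffSum f n : ℝ) : ℂ)) *
    ∑ k ∈ Finset.Icc 1 n, conjPartialSum f k x * (‖coeff f k‖ : ℂ)

/-! Write `x_j` for the jumps, `J_j` for their sizes and `H_k` for the harmonic numbers. A sawtooth
with unit jump has Fourier coefficients `1/(2πiν)`, so the jumps contribute `-(1/π) ∑ J_j cosSum k
(x - x_j)` to the conjugate sum of order `k`. The rest comes from the coefficients `smoothCoeff`,
which satisfy `∑ ν²|smoothCoeff f ν|² < ∞` (`exists_sum_sq_smoothCoeff_le`), so its size and its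
variation are bounded in `k`. The weights `|c_k| / (log n · G(n))` have total mass at most `1/log
n`. Averaging therefore kills everything bounded uniformly in `k`, and up to a term of vanishing
variation `Y_n` is a superposition of spikes `(1/π) J_j spike f n (x - x_j)` (`Yseq_eq`).

The height of a spike at `0` is the weighted mean of the `H_k`. Since the jumps are rational
multiples of `2π`, `|∑ J_j e^{-ikx_j}|` is a uniform limit of periodic sequences in `k`, so it has a
logarithmic mean. The mean is positive because it dominates every `|J_j|`. Hence `∑_{k≤n} |c_k| ~ κ
log n` with `κ > 0`, and Abel summation gives `∑ |c_k| H_k ~ (κ/2) log² n`: the height tends to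
`1/2` (`tendsto_weighted_harmonicSum`).

Upper bound: on each side of its peak `cosSum k` is decreasing up to a linear term, so a spike has
variation at most twice its height plus `o(1)`, hence at most `1 + o(1)`. Away from its peak the
variation is `O(1/log n)`. Summing over the jumps by dominated convergence gives
`exists_tendsto_eVariationOn_le`.

Lower bound: `Y_n(x) → J(x)/(2π)` pointwise (`tendsto_Yseq`). The limit vanishes off a countable
set, so each jump adds a rise and a fall of `|J|/(2π)`, and variation is lower semicontinuous under
pointwise convergence. The two bounds agree, with `K = 1`. -/

open Filter Set MeasureTheory

/-! ### Superadditivity and subadditivity of the variation -/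

section Variation

variable {E : Type*} [PseudoEMetricSpace E]

/-- Variation is superadditive over successive intervals: a point just below the largest element of
`F` separates its contribution from the others, and induction handles the rest. It turns local
bounds at single jumps into a bound by their sum, both for `f` and for the pointwise limit of `Y_n`.
-/
theorem sum_le_eVariationOn_Ioo {f : ℝ → E} {g : ℝ → ENNReal}
    (hg : ∀ z c z', z < c → c < z' → g c ≤ eVariationOn f (Ioo z z')) (F : Finset ℝ) :
    ∀ a b : ℝ, (∀ c ∈ F, c ∈ Ioo a b) → ∑ c ∈ F, g c ≤ eVariationOn f (Ioo a b) := by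
  induction F using Finset.induction_on_max with
  | empty => intro a b _; simp
  | insert m F hm ih =>
    intro a b hF
    have hmem : m ∈ Ioo a b := hF m (Finset.mem_insert_self _ _)
    obtain ⟨z, hz, hzm⟩ : ∃ z, (∀ c ∈ F, c < z) ∧ z ∈ Ioo a m := by
      have hmax : (insert a F).max' (Finset.insert_nonempty _ _) < m := by
        rw [Finset.max'_lt_iff]
        intro y hy
        rcases Finset.mem_insert.1 hy with rfl | hy
        · exact hmem.1
        · exact hm y hy
      obtain ⟨z, hz1, hz2⟩ := exists_between hmax
      refine ⟨z, fun c hc => ?_, ?_, hz2⟩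
      · exact (Finset.le_max' _ _ (Finset.mem_insert_of_mem hc)).trans_lt hz1
      · exact (Finset.le_max' _ _ (Finset.mem_insert_self _ _)).trans_lt hz1
    have hnot : m ∉ F := fun h => lt_irrefl _ (hm m h)
    rw [Finset.sum_insert hnot, add_comm]
    have h1 := ih a z fun c hc => ⟨(hF c (Finset.mem_insert_of_mem hc)).1, hz c hc⟩
    have h2 := hg z m b hzm.2 hmem.2
    calc _ ≤ eVariationOn f (Ioo a z) + eVariationOn f (Ioo z b) := add_le_add h1 h2
      _ ≤ eVariationOn f (Ioo a z ∪ Ioo z b) :=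
        eVariationOn.add_le_union f fun x hx y hy => (hx.2.trans hy.1).le
      _ ≤ _ := eVariationOn.mono _ (union_subset (Ioo_subset_Ioo_right (hzm.2.trans hmem.2).le)
        (Ioo_subset_Ioo_left hzm.1.le))

/-- Along a partition the finite sum of increments can be exchanged with the infinite sum over `i`.
Working in `ENNReal` avoids any summability question; `i` will range over all the jumps. -/
theorem eVariationOn_le_tsum {ι E' : Type*} [PseudoEMetricSpace E'] {h : ℝ → E'} {g : ι → ℝ → E}
    {w : ι → ENNReal} {s : Set ℝ}
    (H : ∀ x ∈ s, ∀ y ∈ s, edist (h x) (h y) ≤ ∑' i, w i * edist (g i x) (g i y)) :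
    eVariationOn h s ≤ ∑' i, w i * eVariationOn (g i) s := by
  refine iSup_le fun p => ?_
  calc _ ≤ ∑ j ∈ Finset.range p.1, ∑' i, w i * edist (g i (p.2.1 (j + 1))) (g i (p.2.1 j)) :=
        Finset.sum_le_sum fun j _ => H _ (p.2.2.2 _) _ (p.2.2.2 _)
    _ = ∑' i, w i * ∑ j ∈ Finset.range p.1, edist (g i (p.2.1 (j + 1))) (g i (p.2.1 j)) := by
        rw [← Summable.tsum_finsetSum fun _ _ => ENNReal.summable]
        simp_rw [Finset.mul_sum]
    _ ≤ _ := ENNReal.tsum_le_tsum fun i => by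
        gcongr
        exact eVariationOn.sum_le p.2.2.1 p.2.2.2

theorem eVariationOn_le_sum {ι E' : Type*} [PseudoEMetricSpace E'] {h : ℝ → E'} {g : ι → ℝ → E}
    {w : ι → ENNReal} {s : Set ℝ} (F : Finset ι)
    (H : ∀ x ∈ s, ∀ y ∈ s, edist (h x) (h y) ≤ ∑ i ∈ F, w i * edist (g i x) (g i y)) :
    eVariationOn h s ≤ ∑ i ∈ F, w i * eVariationOn (g i) s := by
  have := eVariationOn_le_tsum (h := h) (g := fun i : F => g i) (w := fun i : F => w i) (s := s)
  simp only [tsum_fintype] at this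
  rw [← Finset.sum_coe_sort F]
  refine this fun x hx y hy => ?_
  rw [Finset.sum_coe_sort F (fun i => w i * edist (g i x) (g i y))]
  exact H x hx y hy

theorem eVariationOn_add_le {E : Type*} [SeminormedAddCommGroup E] (f g : ℝ → E) (s : Set ℝ) :
    eVariationOn (fun x => f x + g x) s ≤ eVariationOn f s + eVariationOn g s := by
  have := eVariationOn_le_sum (h := fun x => f x + g x) (g := ![f, g]) (w := 1) (s := s)
    Finset.univ fun x _ y _ => by simpa using edist_add_add_le (f x) (g x) (f y) (g y)
  simpa using this

end Variation

theorem eVariationOn_weighted_sum_le {ι : Type*} (F : Finset ι) (w : ι → ℝ) (hw : ∀ i ∈ F, 0 ≤ w i)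
    (g : ι → ℝ → ℝ) (s : Set ℝ) (B : ι → ℝ) (hB : ∀ i ∈ F, 0 ≤ B i)
    (hg : ∀ i ∈ F, eVariationOn (g i) s ≤ ENNReal.ofReal (B i)) :
    eVariationOn (fun x => ∑ i ∈ F, w i * g i x) s ≤ ENNReal.ofReal (∑ i ∈ F, w i * B i) := by
  refine (eVariationOn_le_sum (g := g) (w := fun i => ENNReal.ofReal (w i)) F ?_).trans ?_
  · intro x _ y _
    rw [edist_eq_enorm_sub, ← Finset.sum_sub_distrib]
    refine (enorm_sum_le _ _).trans (Finset.sum_le_sum fun i hi => ?_)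
    rw [← mul_sub, enorm_mul, edist_eq_enorm_sub, Real.enorm_of_nonneg (hw i hi)]
  · rw [ENNReal.ofReal_sum_of_nonneg fun i hi => mul_nonneg (hw i hi) (hB i hi)]
    refine Finset.sum_le_sum fun i hi => ?_
    rw [ENNReal.ofReal_mul (hw i hi)]
    gcongr
    exact hg i hi

/-! ### Harmonic numbers and the variation of the kernels -/

/-- The harmonic numbers, as reals. -/
noncomputable def harmonicSum (n : ℕ) : ℝ := ∑ k ∈ Finset.Icc 1 n, (k : ℝ)⁻¹

/-- The partial sum `∑_{ν=1}^k cos(νt)/ν`. -/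
noncomputable def cosSum (k : ℕ) (t : ℝ) : ℝ := ∑ ν ∈ Finset.Icc 1 k, Real.cos (ν * t) / ν

/-- The conjugate Dirichlet kernel `∑_{ν=1}^k sin(νt)`. -/
noncomputable def sinKernel (k : ℕ) (t : ℝ) : ℝ := ∑ ν ∈ Finset.Icc 1 k, Real.sin (ν * t)

theorem harmonicSum_nonneg (n : ℕ) : 0 ≤ harmonicSum n :=
  Finset.sum_nonneg fun _ _ => by positivity

theorem harmonicSum_eq (n : ℕ) : harmonicSum n = harmonic n := by
  rw [harmonic_eq_sum_Icc, harmonicSum]; push_cast; rfl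

theorem harmonicSum_succ (n : ℕ) : harmonicSum (n + 1) = harmonicSum n + ((n : ℝ) + 1)⁻¹ := by
  rw [harmonicSum, Finset.sum_Icc_succ_top (by omega)]; push_cast; rfl

theorem harmonicSum_mono : Monotone harmonicSum :=
  monotone_nat_of_le_succ fun n => by rw [harmonicSum_succ]; linarith [show 0 ≤ ((n : ℝ) + 1)⁻¹ by positivity]

theorem log_le_harmonicSum (n : ℕ) : Real.log n ≤ harmonicSum n := by
  rw [harmonicSum_eq]
  rcases Nat.eq_zero_or_pos n with rfl | hn
  · simp
  · refine (Real.log_le_log (by exact_mod_cast hn) ?_).trans (log_add_one_le_harmonic n)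
    push_cast; linarith

theorem harmonicSum_le_one_add_log (n : ℕ) : harmonicSum n ≤ 1 + Real.log n := by
  rw [harmonicSum_eq]; exact harmonic_le_one_add_log n

theorem tendsto_log_nat : Tendsto (fun n : ℕ => Real.log n) atTop atTop :=
  Real.tendsto_log_atTop.comp tendsto_natCast_atTop_atTop

theorem tendsto_harmonicSum_atTop : Tendsto harmonicSum atTop atTop :=
  tendsto_atTop_mono log_le_harmonicSum tendsto_log_nat

theorem tendsto_harmonicSum_div_log :
    Tendsto (fun n : ℕ => harmonicSum n / Real.log n) atTop (𝓝 1) := by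
  have h1 : Tendsto (fun n : ℕ => (Real.log n)⁻¹ + 1) atTop (𝓝 1) := by
    simpa using (tendsto_inv_atTop_zero.comp tendsto_log_nat).add_const 1
  refine tendsto_of_tendsto_of_tendsto_of_le_of_le' tendsto_const_nhds h1 ?_ ?_
  · filter_upwards [tendsto_log_nat.eventually_gt_atTop 0] with n hn
    rw [le_div_iff₀ hn, one_mul]; exact log_le_harmonicSum n
  · filter_upwards [tendsto_log_nat.eventually_gt_atTop 0] with n hn
    rw [div_le_iff₀ hn, add_mul, inv_mul_cancel₀ hn.ne', one_mul]; exact harmonicSum_le_one_add_log n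

theorem cosSum_zero_right (k : ℕ) : cosSum k 0 = harmonicSum k := by
  simp [cosSum, harmonicSum]

theorem abs_cosSum_le (k : ℕ) (t : ℝ) : |cosSum k t| ≤ harmonicSum k := by
  refine (Finset.abs_sum_le_sum_abs _ _).trans (Finset.sum_le_sum fun ν _ => ?_)
  rw [abs_div, Nat.abs_cast, div_eq_mul_inv]
  exact mul_le_of_le_one_left (by positivity) (Real.abs_cos_le_one _)

theorem hasDerivAt_cosSum (k : ℕ) (t : ℝ) : HasDerivAt (cosSum k) (-sinKernel k t) t := by
  have : ∀ ν ∈ Finset.Icc 1 k,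
      HasDerivAt (fun t : ℝ => Real.cos (ν * t) / ν) (-Real.sin (ν * t)) t := by
    intro ν hν
    have h0 : (ν : ℝ) ≠ 0 := by
      have := (Finset.mem_Icc.1 hν).1
      positivity
    have h1 : HasDerivAt (fun t : ℝ => (ν : ℝ) * t) ν t := by
      simpa using (hasDerivAt_id t).const_mul (ν : ℝ)
    refine (h1.cos.div_const (ν : ℝ)).congr_deriv ?_
    rw [mul_div_assoc, div_self h0, mul_one]
  have h := HasDerivAt.fun_sum this
  rw [Finset.sum_neg_distrib] at h
  exact h

theorem two_sin_mul_sinKernel (k : ℕ) (t : ℝ) :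
    2 * Real.sin (t / 2) * sinKernel k t = Real.cos (t / 2) - Real.cos (k * t + t / 2) := by
  induction k with
  | zero => simp [sinKernel]
  | succ k ih =>
    have : sinKernel (k + 1) t = sinKernel k t + Real.sin (((k + 1 : ℕ) : ℝ) * t) := by
      rw [sinKernel, Finset.sum_Icc_succ_top (by omega)]; rfl
    rw [this, mul_add, ih]
    have e1 : Real.cos (k * t + t / 2) = Real.cos (((k + 1 : ℕ) : ℝ) * t - t / 2) := by
      congr 1; push_cast; ring
    rw [e1, Real.cos_sub, Real.cos_add]
    ring

/-- By the closed form, `2 sin(t/2) sinKernel k t = cos(t/2)(1 - cos kt) + sin(t/2) sin kt`. The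
first term is nonnegative and the second is at least `-sin(t/2)`. -/
theorem neg_half_le_sinKernel (k : ℕ) {t : ℝ} (ht : t ∈ Ioo 0 Real.pi) :
    -(1 / 2) ≤ sinKernel k t := by
  have hs : 0 < Real.sin (t / 2) :=
    Real.sin_pos_of_pos_of_lt_pi (by linarith [ht.1]) (by linarith [ht.1, ht.2])
  have hc : 0 ≤ Real.cos (t / 2) :=
    Real.cos_nonneg_of_mem_Icc ⟨by linarith [ht.1, Real.pi_pos], by linarith [ht.2]⟩
  have h := two_sin_mul_sinKernel k t
  rw [Real.cos_add] at h
  have h2 : 0 ≤ Real.cos (t / 2) * (1 - Real.cos (k * t)) :=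
    mul_nonneg hc (by linarith [Real.cos_le_one (k * t)])
  have h3 : 0 ≤ Real.sin (t / 2) * (1 + Real.sin (k * t)) :=
    mul_nonneg hs.le (by linarith [Real.neg_one_le_sin (k * t)])
  by_contra hlt
  push Not at hlt
  nlinarith [mul_pos hs (show 0 < -(1 / 2) - sinKernel k t by linarith)]

theorem antitoneOn_cosSum_sub (k : ℕ) :
    AntitoneOn (fun t => cosSum k t - t / 2) (Icc 0 Real.pi) := by
  have hd : ∀ t, HasDerivAt (fun t => cosSum k t - t / 2) (-sinKernel k t - 1 / 2) t := fun t =>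
    (hasDerivAt_cosSum k t).sub ((hasDerivAt_id t).div_const 2)
  refine antitoneOn_of_deriv_nonpos (convex_Icc _ _)
    (fun t _ => (hd t).continuousAt.continuousWithinAt)
    (fun t _ => (hd t).differentiableAt.differentiableWithinAt) fun t ht => ?_
  rw [interior_Icc] at ht
  rw [(hd t).deriv]
  linarith [neg_half_le_sinKernel k ht]

/-- `cosSum k` is an antitone function plus `t / 2`, so its variation is nearly its total drop from
the value `harmonicSum k` at `0`. The coefficient `1` of `harmonicSum k` is what makes the final
upper bound sharp. -/
theorem eVariationOn_cosSum_Icc_pi (k : ℕ) :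
    eVariationOn (cosSum k) (Icc 0 Real.pi) ≤
      ENNReal.ofReal (harmonicSum k + (|cosSum k Real.pi| + Real.pi)) := by
  have h0 : (0 : ℝ) ∈ Icc 0 Real.pi := ⟨le_rfl, Real.pi_pos.le⟩
  have hp : Real.pi ∈ Icc 0 Real.pi := ⟨Real.pi_pos.le, le_rfl⟩
  have e : cosSum k = fun t => (cosSum k t - t / 2) + t / 2 := by ext; ring
  have h1 : eVariationOn (fun t => cosSum k t - t / 2) (Icc 0 Real.pi) ≤
      ENNReal.ofReal (cosSum k 0 - (cosSum k Real.pi - Real.pi / 2)) := by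
    have hm : MonotoneOn (fun t => -(cosSum k t - t / 2)) (Icc 0 Real.pi) :=
      (antitoneOn_cosSum_sub k).neg
    have := (hm.eVariationOn_eq h0 hp).le
    rw [inter_self] at this
    have e2 : eVariationOn (fun t => cosSum k t - t / 2) (Icc 0 Real.pi) =
        eVariationOn (fun t => -(cosSum k t - t / 2)) (Icc 0 Real.pi) := by
      simp only [eVariationOn, edist_neg_neg]
    rw [e2]
    refine this.trans (ENNReal.ofReal_le_ofReal ?_)
    simp; linarith
  have h2 : eVariationOn (fun t : ℝ => t / 2) (Icc 0 Real.pi) ≤ ENNReal.ofReal (Real.pi / 2) := by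
    have hm : MonotoneOn (fun t : ℝ => t / 2) (Icc 0 Real.pi) := fun x _ y _ h => by
      simpa using (by linarith : x / 2 ≤ y / 2)
    have := (hm.eVariationOn_eq h0 hp).le
    rw [inter_self] at this
    simpa using this
  have hnn : 0 ≤ cosSum k 0 - (cosSum k Real.pi - Real.pi / 2) := by
    have := antitoneOn_cosSum_sub k h0 hp Real.pi_pos.le
    simp only at this; linarith
  rw [e]
  refine (eVariationOn_add_le _ _ _).trans ((add_le_add h1 h2).trans ?_)
  rw [← ENNReal.ofReal_add hnn (by positivity)]
  refine ENNReal.ofReal_le_ofReal ?_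
  rw [cosSum_zero_right]
  have h3 := neg_abs_le (cosSum k Real.pi)
  simp only [sub_add_cancel]
  linarith

theorem cosSum_neg (k : ℕ) (t : ℝ) : cosSum k (-t) = cosSum k t := by
  simp [cosSum]

theorem cosSum_two_pi_sub (k : ℕ) (t : ℝ) : cosSum k (2 * Real.pi - t) = cosSum k t := by
  refine Finset.sum_congr rfl fun ν _ => ?_
  rw [mul_sub, Real.cos_nat_mul_two_pi_sub]

theorem eVariationOn_cosSum_reflect (k : ℕ) (a b : ℝ) :
    eVariationOn (cosSum k) (Icc (2 * Real.pi - b) (2 * Real.pi - a)) =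
      eVariationOn (cosSum k) (Icc a b) := by
  have h := eVariationOn.comp_eq_of_antitoneOn (cosSum k) (t := Icc a b)
    (fun t => 2 * Real.pi - t) (fun x _ y _ h => sub_le_sub_left h _)
  rw [image_const_sub_Icc] at h
  rw [← h]
  exact eVariationOn.congr fun t _ => cosSum_two_pi_sub k t

theorem eVariationOn_cosSum_neg (k : ℕ) (a b : ℝ) :
    eVariationOn (cosSum k) (Icc (-b) (-a)) = eVariationOn (cosSum k) (Icc a b) := by
  have h := eVariationOn.comp_eq_of_antitoneOn (cosSum k) (t := Icc a b)
    (fun t => -t) (fun x _ y _ h => by simpa using h)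
  rw [image_neg_Icc] at h
  rw [← h]
  exact eVariationOn.congr fun t _ => cosSum_neg k t

theorem eVariationOn_cosSum_Icc_add (k : ℕ) {a b c : ℝ} (hab : a ≤ b) (hbc : b ≤ c) :
    eVariationOn (cosSum k) (Icc a b) + eVariationOn (cosSum k) (Icc b c) =
      eVariationOn (cosSum k) (Icc a c) := by
  simpa using eVariationOn.Icc_add_Icc (cosSum k) hab hbc (mem_univ b)

/-- Evenness and the symmetry `t ↦ 2π - t` move the two pieces of `[-x, 2π - x]` on either side of
`0` onto `[0, x]` and `[x, 2π]`. Together they form a full period, which is twice `[0, π]`. -/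
theorem eVariationOn_cosSum_sub {x : ℝ} (hx : x ∈ Ioo 0 (2 * Real.pi)) (k : ℕ) :
    eVariationOn (fun t => cosSum k (t - x)) (Icc 0 (2 * Real.pi)) ≤
      ENNReal.ofReal (2 * harmonicSum k + 2 * (|cosSum k Real.pi| + Real.pi)) := by
  have hpi := Real.pi_pos
  have h := eVariationOn.comp_eq_of_monotoneOn (cosSum k) (t := Icc 0 (2 * Real.pi))
    (fun t => t - x) (fun x _ y _ h => by simpa using h)
  rw [image_sub_const_Icc] at h
  have e : eVariationOn (fun t => cosSum k (t - x)) (Icc 0 (2 * Real.pi)) =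
      eVariationOn (cosSum k) (Icc (0 - x) (2 * Real.pi - x)) := h
  have e1 := eVariationOn_cosSum_neg k 0 x
  have e2 := eVariationOn_cosSum_reflect k x (2 * Real.pi)
  have e3 := eVariationOn_cosSum_reflect k 0 Real.pi
  rw [neg_zero] at e1
  rw [sub_self] at e2
  rw [show 2 * Real.pi - Real.pi = Real.pi by ring, sub_zero] at e3
  rw [e, zero_sub, ← eVariationOn_cosSum_Icc_add k (b := 0) (by linarith [hx.1]) (by linarith [hx.2]),
    e1, e2, eVariationOn_cosSum_Icc_add k hx.1.le hx.2.le,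
    ← eVariationOn_cosSum_Icc_add k hpi.le (by linarith), e3]
  refine (add_le_add (eVariationOn_cosSum_Icc_pi k) (eVariationOn_cosSum_Icc_pi k)).trans ?_
  have := harmonicSum_nonneg k
  rw [← ENNReal.ofReal_add (by positivity) (by positivity)]
  exact ENNReal.ofReal_le_ofReal (by linarith)

/-- On `[a, b]` the sine of `(t - x)/2` does not vanish, so by compactness it is bounded away from
`0`. The conjugate kernel is then bounded uniformly in `k`, and the functions are uniformly
Lipschitz. -/
theorem exists_eVariationOn_cosSum_sub_le {x a b : ℝ} (hx : x ∈ Ioo 0 (2 * Real.pi)) (ha : 0 ≤ a)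
    (hb : b ≤ 2 * Real.pi) (hab : a ≤ b) (hxab : x ∉ Icc a b) :
    ∃ B : ℝ, 0 ≤ B ∧ ∀ k, eVariationOn (fun t => cosSum k (t - x)) (Icc a b) ≤ ENNReal.ofReal B := by
  have hpi := Real.pi_pos
  have hne : ∀ t ∈ Icc a b, Real.sin ((t - x) / 2) ≠ 0 := by
    intro t ht h0
    have h1 : t ≠ x := by rintro rfl; exact hxab ht
    have := Real.sin_eq_zero_iff_of_lt_of_lt (x := (t - x) / 2) (by linarith [ht.1, hx.2])
      (by linarith [ht.2, hx.1])
    have := this.1 h0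
    exact h1 (by linarith)
  obtain ⟨t0, ht0, hmin⟩ := isCompact_Icc.exists_isMinOn (s := Icc a b) (nonempty_Icc.2 hab)
    (f := fun t => |Real.sin ((t - x) / 2)|) (by fun_prop)
  set s := |Real.sin ((t0 - x) / 2)| with hs
  have hspos : 0 < s := abs_pos.2 (hne t0 ht0)
  have hbound : ∀ k : ℕ, ∀ t ∈ Icc a b, |sinKernel k (t - x)| ≤ s⁻¹ := by
    intro k t ht
    have h1 := two_sin_mul_sinKernel k (t - x)
    have h2 : |2 * Real.sin ((t - x) / 2) * sinKernel k (t - x)| ≤ 2 := by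
      rw [h1]
      refine (abs_sub _ _).trans ?_
      linarith [Real.abs_cos_le_one ((t - x) / 2), Real.abs_cos_le_one (k * (t - x) + (t - x) / 2)]
    rw [abs_mul, abs_mul, abs_two] at h2
    have h3 : s ≤ |Real.sin ((t - x) / 2)| := hmin ht
    rw [← one_div, le_div_iff₀ hspos]
    nlinarith [abs_nonneg (sinKernel k (t - x))]
  refine ⟨s⁻¹ * (b - a), by have := sub_nonneg.2 hab; positivity, fun k => ?_⟩
  have hd : ∀ t ∈ Icc a b, HasDerivWithinAt (fun t => cosSum k (t - x)) (-sinKernel k (t - x))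
      (Icc a b) t := fun t _ => ((hasDerivAt_cosSum k (t - x)).comp_sub_const t x).hasDerivWithinAt
  have hL : LipschitzOnWith s⁻¹.toNNReal (fun t => cosSum k (t - x)) (Icc a b) :=
    (convex_Icc a b).lipschitzOnWith_of_nnnorm_hasDerivWithin_le hd fun t ht => by
      rw [← NNReal.coe_le_coe, coe_nnnorm, norm_neg, Real.coe_toNNReal _ (by positivity)]
      exact hbound k t ht
  refine (hL.comp_eVariationOn_le (f := fun t => cosSum k (t - x)) (g := id)
    (mapsTo_id (Icc a b))).trans ?_
  rw [eVariationOn_id_Icc, ENNReal.ofReal_mul (by positivity)]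
  rfl

/-! ### Dirichlet's test -/

theorem sum_Icc_one_eq_sum_range {M : Type*} [AddCommMonoid M] (f : ℕ → M) (n : ℕ) :
    ∑ k ∈ Finset.Icc 1 n, f k = ∑ k ∈ Finset.range n, f (k + 1) := by
  rw [Finset.range_eq_Ico, Finset.sum_Ico_add' f 0 n 1]
  rfl

/-- Dirichlet's test: bounded partial sums against the decreasing null sequence `1/k` give a Cauchy,
hence bounded, sequence. -/
theorem exists_norm_sum_inv_smul_le {E : Type*} [NormedAddCommGroup E] [NormedSpace ℝ E]
    {a : ℕ → E} {b : ℝ} (hb : ∀ n, ‖∑ k ∈ Finset.range n, a (k + 1)‖ ≤ b) :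
    ∃ B, ∀ n : ℕ, ‖∑ k ∈ Finset.Icc 1 n, (k : ℝ)⁻¹ • a k‖ ≤ B := by
  have h1 : Antitone fun n : ℕ => ((n : ℝ) + 1)⁻¹ := fun m n h => by
    have : (m : ℝ) ≤ n := by exact_mod_cast h
    simp only
    gcongr
  have h2 : Tendsto (fun n : ℕ => ((n : ℝ) + 1)⁻¹) atTop (𝓝 0) := by
    simpa using tendsto_one_div_add_atTop_nhds_zero_nat (𝕜 := ℝ)
  obtain ⟨B, -, hB⟩ := cauchySeq_bdd (h1.cauchySeq_series_mul_of_tendsto_zero_of_bounded h2 hb)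
  refine ⟨B, fun n => ?_⟩
  have := hB n 0
  rw [sum_Icc_one_eq_sum_range]
  simpa [dist_eq_norm] using this.le

theorem exists_norm_sum_inv_mul_exp_le {t : ℝ} (ht : Complex.exp (t * Complex.I) ≠ 1) :
    ∃ B, ∀ n : ℕ, ‖∑ k ∈ Finset.Icc 1 n, (k : ℝ)⁻¹ • Complex.exp (t * Complex.I) ^ k‖ ≤ B := by
  set e := Complex.exp (t * Complex.I) with he
  have hn : ‖e‖ = 1 := Complex.norm_exp_ofReal_mul_I t
  refine exists_norm_sum_inv_smul_le (b := 2 / ‖e - 1‖) fun n => ?_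
  simp_rw [pow_succ]
  rw [← Finset.sum_mul, norm_mul, hn, mul_one, geom_sum_eq ht, norm_div]
  gcongr
  refine (norm_sub_le _ _).trans ?_
  rw [norm_pow, hn]
  norm_num

theorem exp_mul_I_ne_one {t : ℝ} (h0 : t ≠ 0) (h1 : -(2 * Real.pi) < t) (h2 : t < 2 * Real.pi) :
    Complex.exp (t * Complex.I) ≠ 1 := by
  intro h
  have h3 := congrArg Complex.re h
  rw [Complex.exp_ofReal_mul_I_re, Complex.one_re] at h3
  exact h0 ((Real.cos_eq_one_iff_of_lt_of_lt h1 h2).1 h3)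

theorem exists_abs_cosSum_le {t : ℝ} (ht : Complex.exp (t * Complex.I) ≠ 1) :
    ∃ B, ∀ n, |cosSum n t| ≤ B := by
  obtain ⟨B, hB⟩ := exists_norm_sum_inv_mul_exp_le ht
  refine ⟨B, fun n => le_trans ?_ (hB n)⟩
  have : cosSum n t =
      (∑ k ∈ Finset.Icc 1 n, (k : ℝ)⁻¹ • Complex.exp (t * Complex.I) ^ k).re := by
    rw [Complex.re_sum]
    refine Finset.sum_congr rfl fun k _ => ?_
    rw [Complex.smul_re, ← Complex.exp_nat_mul, ← mul_assoc]
    have := Complex.exp_ofReal_mul_I_re (k * t)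
    push_cast at this
    rw [this, smul_eq_mul]
    ring
  rw [this]
  exact Complex.abs_re_le_norm _

theorem exists_abs_cosSum_pi_le : ∃ B, ∀ n, |cosSum n Real.pi| ≤ B :=
  exists_abs_cosSum_le (exp_mul_I_ne_one Real.pi_ne_zero (by linarith [Real.pi_pos])
    (by linarith [Real.pi_pos]))

/-! ### Logarithmic means -/

/-- `a` has logarithmic mean `m`. -/
def HasLogMean {E : Type*} [NormedAddCommGroup E] [NormedSpace ℝ E] (a : ℕ → E) (m : E) : Prop :=
  Tendsto (fun n : ℕ => (harmonicSum n)⁻¹ • ∑ k ∈ Finset.Icc 1 n, (k : ℝ)⁻¹ • a k) atTop (𝓝 m)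

section LogMean

variable {E : Type*} [NormedAddCommGroup E] [NormedSpace ℝ E]

theorem hasLogMean_zero_of_bounded {a : ℕ → E} {B : ℝ}
    (hB : ∀ n : ℕ, ‖∑ k ∈ Finset.Icc 1 n, (k : ℝ)⁻¹ • a k‖ ≤ B) : HasLogMean a 0 := by
  have h := (tendsto_inv_atTop_zero.comp tendsto_harmonicSum_atTop).mul_const B
  rw [zero_mul] at h
  refine squeeze_zero_norm (fun n => ?_) h
  rw [norm_smul, Real.norm_of_nonneg (inv_nonneg.2 (harmonicSum_nonneg n))]
  exact mul_le_mul_of_nonneg_left (hB n) (inv_nonneg.2 (harmonicSum_nonneg n))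

theorem hasLogMean_const (c : E) : HasLogMean (fun _ => c) c := by
  refine tendsto_const_nhds.congr' ?_
  filter_upwards [tendsto_harmonicSum_atTop.eventually_gt_atTop 0] with n hn
  rw [← Finset.sum_smul, smul_smul]
  change c = ((harmonicSum n)⁻¹ * harmonicSum n) • c
  rw [inv_mul_cancel₀ hn.ne', one_smul]

theorem HasLogMean.add {a b : ℕ → E} {x y : E} (ha : HasLogMean a x) (hb : HasLogMean b y) :
    HasLogMean (fun k => a k + b k) (x + y) := by
  refine (Tendsto.add ha hb).congr fun n => ?_
  simp only [smul_add, Finset.sum_add_distrib]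

theorem norm_logMean_le {a : ℕ → E} {b : ℝ} (hb : 0 ≤ b) (h : ∀ k, ‖a k‖ ≤ b) (n : ℕ) :
    ‖(harmonicSum n)⁻¹ • ∑ k ∈ Finset.Icc 1 n, (k : ℝ)⁻¹ • a k‖ ≤ b := by
  rw [norm_smul, Real.norm_of_nonneg (inv_nonneg.2 (harmonicSum_nonneg n))]
  have h1 : ‖∑ k ∈ Finset.Icc 1 n, (k : ℝ)⁻¹ • a k‖ ≤ harmonicSum n * b := by
    refine (norm_sum_le _ _).trans ?_
    rw [harmonicSum, Finset.sum_mul]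
    refine Finset.sum_le_sum fun k _ => ?_
    rw [norm_smul, Real.norm_of_nonneg (by positivity)]
    exact mul_le_mul_of_nonneg_left (h k) (by positivity)
  calc _ ≤ (harmonicSum n)⁻¹ * (harmonicSum n * b) :=
        mul_le_mul_of_nonneg_left h1 (inv_nonneg.2 (harmonicSum_nonneg n))
    _ = ((harmonicSum n)⁻¹ * harmonicSum n) * b := by ring
    _ ≤ 1 * b := mul_le_mul_of_nonneg_right (inv_mul_le_one) hb
    _ = b := one_mul b

/-- Logarithmic averaging does not increase the sup norm, so uniform approximation makes the
averages of `a` Cauchy. -/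
theorem exists_hasLogMean_of_approx [CompleteSpace E] {a : ℕ → E}
    (H : ∀ ε > 0, ∃ b : ℕ → E, (∃ m, HasLogMean b m) ∧ ∀ k, ‖a k - b k‖ ≤ ε) :
    ∃ m, HasLogMean a m := by
  refine cauchySeq_tendsto_of_complete (Metric.cauchySeq_iff.2 fun ε hε => ?_)
  obtain ⟨b, ⟨m, hm⟩, hb⟩ := H (ε / 4) (by positivity)
  obtain ⟨N, hN⟩ := Metric.cauchySeq_iff.1 (Tendsto.cauchySeq hm) (ε / 4) (by positivity)
  refine ⟨N, fun p hp q hq => ?_⟩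
  have key : ∀ n, dist ((harmonicSum n)⁻¹ • ∑ k ∈ Finset.Icc 1 n, (k : ℝ)⁻¹ • a k)
      ((harmonicSum n)⁻¹ • ∑ k ∈ Finset.Icc 1 n, (k : ℝ)⁻¹ • b k) ≤ ε / 4 := fun n => by
    rw [dist_eq_norm, ← smul_sub, ← Finset.sum_sub_distrib]
    simp_rw [← smul_sub]
    exact norm_logMean_le (by positivity) hb n
  have h1 := hN p hp q hq
  have h2 := dist_triangle4 ((harmonicSum p)⁻¹ • ∑ k ∈ Finset.Icc 1 p, (k : ℝ)⁻¹ • a k)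
    ((harmonicSum p)⁻¹ • ∑ k ∈ Finset.Icc 1 p, (k : ℝ)⁻¹ • b k)
    ((harmonicSum q)⁻¹ • ∑ k ∈ Finset.Icc 1 q, (k : ℝ)⁻¹ • b k)
    ((harmonicSum q)⁻¹ • ∑ k ∈ Finset.Icc 1 q, (k : ℝ)⁻¹ • a k)
  have h3 := key p
  have h4 := key q
  rw [dist_comm] at h4
  linarith

end LogMean

/-- Once the average over a period is subtracted, the partial sums are themselves periodic, hence
bounded, and Dirichlet's test gives logarithmic mean `0`. -/
theorem exists_hasLogMean_of_periodic {a : ℕ → ℝ} {q : ℕ} (hq : 0 < q)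
    (ha : Function.Periodic a q) : ∃ m, HasLogMean a m := by
  set m := (q : ℝ)⁻¹ * ∑ i ∈ Finset.range q, a i with hm
  have hq' : (q : ℝ) ≠ 0 := by positivity
  set θ : ℕ → ℝ := fun k => a k - m with hθ
  have hper : Function.Periodic θ q := fun k => by simp only [hθ, ha k]
  have hblock : ∀ n, ∑ i ∈ Finset.range q, θ (n + i) = 0 := by
    intro n
    induction n with
    | zero =>
      have h1 : (q : ℝ) * m = ∑ i ∈ Finset.range q, a i := mul_inv_cancel_left₀ hq' _
      have h2 : ∀ i, θ (0 + i) = a i - m := fun i => by rw [zero_add]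
      rw [Finset.sum_congr rfl fun i _ => h2 i, Finset.sum_sub_distrib,
        Finset.sum_const, Finset.card_range, nsmul_eq_mul, h1, sub_self]
    | succ n ih =>
      have h1 := Finset.sum_range_succ (fun i => θ (n + i)) q
      have h2 := Finset.sum_range_succ' (fun i => θ (n + i)) q
      have h3 : ∑ i ∈ Finset.range q, θ (n + (i + 1)) = ∑ i ∈ Finset.range q, θ (n + 1 + i) :=
        Finset.sum_congr rfl fun i _ => by rw [add_right_comm, add_assoc]
      rw [hper n] at h1
      rw [h3, add_zero] at h2
      linarith
  set S : ℕ → ℝ := fun n => ∑ k ∈ Finset.range n, θ (k + 1) with hS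
  have hSper : Function.Periodic S q := fun n => by
    simp only [hS, Finset.sum_range_add]
    have := hblock (n + 1)
    simp only [add_right_comm n 1] at this
    rw [this, add_zero]
  have hSb : ∀ n, ‖S n‖ ≤ ∑ i ∈ Finset.range q, ‖S i‖ := fun n => by
    rw [← hSper.map_mod_nat n]
    exact Finset.single_le_sum (f := fun i => ‖S i‖) (fun _ _ => norm_nonneg _)
      (Finset.mem_range.2 (Nat.mod_lt n hq))
  obtain ⟨B, hB⟩ := exists_norm_sum_inv_smul_le hSb
  refine ⟨0 + m, ?_⟩
  simpa [hθ] using (hasLogMean_zero_of_bounded hB).add (hasLogMean_const m)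

/-! ### Logarithmic mean of the modulus of the jump sum -/

section Trigonometric

variable {ι : Type*} {J x : ι → ℝ}

theorem summable_jump_exp (hJ : Summable fun j => |J j|) (k : ℕ) :
    Summable fun j => (J j : ℂ) * Complex.exp (-(x j * Complex.I)) ^ k := by
  refine Summable.of_norm_bounded hJ fun j => ?_
  rw [norm_mul, norm_pow, ← neg_mul, ← Complex.ofReal_neg, Complex.norm_exp_ofReal_mul_I]
  simp

/-- With finitely many jumps the sequence is periodic in `k`, because the jumps are rational
multiples of `2π`. The tail of `∑ |J j|` controls the truncation error uniformly in `k`. -/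
theorem exists_hasLogMean_norm_tsum (hJ : Summable fun j => |J j|)
    (hx : ∀ j, ∃ q : ℚ, x j = q * (2 * Real.pi)) :
    ∃ m, HasLogMean (fun k => ‖∑' j, (J j : ℂ) * Complex.exp (-(x j * Complex.I)) ^ k‖) m := by
  choose q hq using hx
  refine exists_hasLogMean_of_approx fun ε hε => ?_
  obtain ⟨F, hF⟩ :=
    ((tendsto_order.1 (tendsto_tsum_compl_atTop_zero fun j => |J j|)).2 ε hε).exists
  refine ⟨fun k => ‖∑ j ∈ F, (J j : ℂ) * Complex.exp (-(x j * Complex.I)) ^ k‖, ?_, fun k => ?_⟩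
  -- The product of the denominators is a common period of the powers in the truncated sum.
  · refine exists_hasLogMean_of_periodic (q := ∏ j ∈ F, (q j).den)
      (Finset.prod_pos fun j _ => (q j).den_pos) fun k => ?_
    refine congrArg norm (Finset.sum_congr rfl fun j hj => ?_)
    rw [pow_add]
    have h1 : Complex.exp (-(x j * Complex.I)) ^ (q j).den = 1 := by
      rw [← Complex.exp_nat_mul, hq j, Complex.exp_eq_one_iff]
      refine ⟨-(q j).num, ?_⟩
      have : ((q j : ℚ) : ℂ) * ((q j).den : ℂ) = (q j).num := by
        exact_mod_cast Rat.mul_den_eq_num (q j)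
      push_cast
      linear_combination (-(2 * Real.pi * Complex.I)) * this
    obtain ⟨c, hc⟩ := Finset.dvd_prod_of_mem (fun j => (q j).den) hj
    rw [hc, pow_mul, h1, one_pow, mul_one]
  · have hs := summable_jump_exp (x := x) hJ k
    rw [Real.norm_eq_abs]
    refine (abs_norm_sub_norm_le _ _).trans ?_
    rw [← hs.sum_add_tsum_compl (s := F), add_sub_cancel_left]
    refine le_trans (tsum_of_norm_bounded (hJ.subtype _).hasSum fun j => ?_) hF.le
    rw [norm_mul, norm_pow, ← neg_mul, ← Complex.ofReal_neg, Complex.norm_exp_ofReal_mul_I]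
    simp

/-- After multiplication by `e^{ikx_{j₀}}`, which leaves the modulus unchanged, the term `j₀` is
constant and each other term has logarithmic mean `0`. So the complex sequence has mean `J j₀`, and
the modulus of a mean is at most the mean of the moduli. This makes the mean positive as soon as
there is a jump. -/
theorem abs_jump_le_logMean (hJ : Summable fun j => |J j|) (hinj : Function.Injective x)
    (hx : ∀ j, x j ∈ Ioo 0 (2 * Real.pi)) {m : ℝ}
    (hm : HasLogMean (fun k => ‖∑' j, (J j : ℂ) * Complex.exp (-(x j * Complex.I)) ^ k‖) m)
    (j₀ : ι) : |J j₀| ≤ m := by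
  classical
  have hnorm : ∀ t : ℝ, ‖Complex.exp (t * Complex.I)‖ = 1 := Complex.norm_exp_ofReal_mul_I
  have hlim : ∀ j, HasLogMean
      (fun k => (J j : ℂ) * Complex.exp (((x j₀ - x j : ℝ) : ℂ) * Complex.I) ^ k)
      (if j = j₀ then (J j₀ : ℂ) else 0) := by
    intro j
    split_ifs with h
    · subst h
      simpa using hasLogMean_const (J j : ℂ)
    · have hne : x j₀ - x j ≠ 0 := fun h0 => h (hinj (by linarith))
      obtain ⟨B, hB⟩ := exists_norm_sum_inv_mul_exp_le (exp_mul_I_ne_one hne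
        (by linarith [(hx j₀).1, (hx j).2]) (by linarith [(hx j₀).2, (hx j).1]))
      refine hasLogMean_zero_of_bounded (B := |J j| * B) fun n => ?_
      have : ∀ k : ℕ, (k : ℝ)⁻¹ • ((J j : ℂ) * Complex.exp (((x j₀ - x j : ℝ) : ℂ) * Complex.I) ^ k)
          = (J j : ℂ) * ((k : ℝ)⁻¹ • Complex.exp (((x j₀ - x j : ℝ) : ℂ) * Complex.I) ^ k) :=
        fun k => by rw [mul_smul_comm]
      simp_rw [this]
      rw [← Finset.mul_sum, norm_mul, Complex.norm_real, Real.norm_eq_abs]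
      exact mul_le_mul_of_nonneg_left (hB n) (abs_nonneg _)
  have hdom := tendsto_tsum_of_dominated_convergence (bound := fun j => |J j|) hJ hlim
    (Eventually.of_forall fun n j => norm_logMean_le (abs_nonneg _) (fun k => by
      rw [norm_mul, norm_pow, hnorm, one_pow, mul_one, Complex.norm_real, Real.norm_eq_abs]) n)
  rw [tsum_ite_eq] at hdom
  have hle := le_of_tendsto_of_tendsto hdom.norm hm (Eventually.of_forall fun n => ?_)
  · simpa using hle
  have hs : ∀ k : ℕ, Summable fun j => (k : ℝ)⁻¹ •
      ((J j : ℂ) * Complex.exp (((x j₀ - x j : ℝ) : ℂ) * Complex.I) ^ k) := fun k => by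
    refine Summable.const_smul _ (Summable.of_norm_bounded hJ fun j => ?_)
    rw [norm_mul, norm_pow, hnorm, one_pow, mul_one, Complex.norm_real, Real.norm_eq_abs]
  simp only
  rw [tsum_const_smul'', Summable.tsum_finsetSum fun k _ => hs k, norm_smul,
    Real.norm_of_nonneg (inv_nonneg.2 (harmonicSum_nonneg n)), smul_eq_mul]
  refine mul_le_mul_of_nonneg_left ((norm_sum_le _ _).trans (Finset.sum_le_sum fun k _ => ?_))
    (inv_nonneg.2 (harmonicSum_nonneg n))
  have e : ∀ j, (J j : ℂ) * Complex.exp (((x j₀ - x j : ℝ) : ℂ) * Complex.I) ^ k =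
      Complex.exp (x j₀ * Complex.I) ^ k * ((J j : ℂ) * Complex.exp (-(x j * Complex.I)) ^ k) := by
    intro j
    push_cast
    rw [sub_mul, sub_eq_add_neg, Complex.exp_add, mul_pow]
    ring
  simp_rw [e]
  rw [tsum_const_smul'', tsum_mul_left, norm_smul, norm_mul, norm_pow, hnorm, one_pow, one_mul,
    Real.norm_of_nonneg (by positivity), smul_eq_mul]

end Trigonometric

/-! ### Weighted means of the harmonic numbers -/

theorem sum_mul_harmonicSum (a : ℕ → ℝ) (n : ℕ) :
    ∑ k ∈ Finset.Icc 1 n, a k * harmonicSum k =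
      (∑ k ∈ Finset.Icc 1 n, a k) * harmonicSum n -
        ∑ i ∈ Finset.range n, (∑ k ∈ Finset.Icc 1 i, a k) * ((i : ℝ) + 1)⁻¹ := by
  induction n with
  | zero => simp
  | succ n ih =>
    rw [Finset.sum_Icc_succ_top (by omega), Finset.sum_Icc_succ_top (by omega),
      Finset.sum_range_succ, ih, harmonicSum_succ]
    ring

/-- Telescoping of `H_{i+1}² - H_i² = 2 H_i/(i+1) + 1/(i+1)²`. The factor `1/2` here is the source
of the limiting height of the spikes. -/
theorem sum_harmonicSum_mul_inv (n : ℕ) :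
    ∑ i ∈ Finset.range n, harmonicSum i * ((i : ℝ) + 1)⁻¹ =
      (harmonicSum n ^ 2 - ∑ i ∈ Finset.range n, (((i : ℝ) + 1)⁻¹) ^ 2) / 2 := by
  induction n with
  | zero => simp [harmonicSum]
  | succ n ih =>
    rw [Finset.sum_range_succ, Finset.sum_range_succ, ih, harmonicSum_succ]
    ring

theorem tendsto_sum_harmonicSum_mul_inv_div :
    Tendsto (fun n => (∑ i ∈ Finset.range n, harmonicSum i * ((i : ℝ) + 1)⁻¹) / harmonicSum n ^ 2)
      atTop (𝓝 (1 / 2)) := by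
  have h0 : Tendsto (fun n => (harmonicSum n)⁻¹) atTop (𝓝 0) :=
    tendsto_inv_atTop_zero.comp tendsto_harmonicSum_atTop
  have h1 : Tendsto (fun n => 1 / 2 - (harmonicSum n)⁻¹ / 2) atTop (𝓝 (1 / 2)) := by
    simpa only [zero_div, sub_zero] using (h0.div_const 2).const_sub (1 / 2)
  have hb : ∀ n, ∑ i ∈ Finset.range n, (((i : ℝ) + 1)⁻¹) ^ 2 ≤ harmonicSum n := fun n => by
    rw [harmonicSum, sum_Icc_one_eq_sum_range]
    refine Finset.sum_le_sum fun i _ => ?_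
    push_cast
    have h2 : ((i : ℝ) + 1)⁻¹ ≤ 1 := inv_le_one_of_one_le₀ (by linarith [Nat.cast_nonneg (α := ℝ) i])
    have h3 : 0 ≤ ((i : ℝ) + 1)⁻¹ := by positivity
    nlinarith
  refine tendsto_of_tendsto_of_tendsto_of_le_of_le' h1 tendsto_const_nhds ?_ ?_
  · filter_upwards [tendsto_harmonicSum_atTop.eventually_gt_atTop 0] with n hn
    rw [sum_harmonicSum_mul_inv, le_div_iff₀ (by positivity)]
    have : (1 / 2 - (harmonicSum n)⁻¹ / 2) * harmonicSum n ^ 2 =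
        (harmonicSum n ^ 2 - harmonicSum n) / 2 := by field_simp
    rw [this]
    linarith [hb n]
  · filter_upwards [tendsto_harmonicSum_atTop.eventually_gt_atTop 0] with n hn
    rw [sum_harmonicSum_mul_inv, div_le_iff₀ (by positivity)]
    have : 0 ≤ ∑ i ∈ Finset.range n, (((i : ℝ) + 1)⁻¹) ^ 2 :=
      Finset.sum_nonneg fun _ _ => by positivity
    linarith

/-- If the partial sums of `a` grow like `κ log n`, then the weighted mean of the harmonic numbers
with weights `a` is asymptotic to `(log n) / 2`. -/
theorem tendsto_sum_mul_harmonicSum_div {a : ℕ → ℝ} {κ : ℝ}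
    (h : Tendsto (fun n => (∑ k ∈ Finset.Icc 1 n, a k) / harmonicSum n) atTop (𝓝 κ)) :
    Tendsto (fun n => (∑ k ∈ Finset.Icc 1 n, a k * harmonicSum k) / harmonicSum n ^ 2)
      atTop (𝓝 (κ / 2)) := by
  set A : ℕ → ℝ := fun n => ∑ k ∈ Finset.Icc 1 n, a k with hA
  have hpos : ∀ᶠ n in atTop, 0 < harmonicSum n := tendsto_harmonicSum_atTop.eventually_gt_atTop 0
  -- In the Abel sum `A i` may be replaced by `κ * harmonicSum i`: the error is negligible term by
  -- term, and summation preserves this because the comparison series diverges.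
  have ho : (fun n : ℕ => (A n - κ * harmonicSum n) * ((n : ℝ) + 1)⁻¹) =o[atTop]
      fun n : ℕ => harmonicSum n * ((n : ℝ) + 1)⁻¹ := by
    refine Asymptotics.IsLittleO.mul_isBigO ?_ (Asymptotics.isBigO_refl _ _)
    refine (Asymptotics.isLittleO_iff_tendsto' ?_).2 ?_
    · filter_upwards [hpos] with n hn h0
      exact absurd h0 hn.ne'
    · have := h.sub_const κ
      rw [sub_self] at this
      refine this.congr' ?_
      filter_upwards [hpos] with n hn
      field_simp
      simp only [hA]
  have hdiv : Tendsto (fun n => ∑ i ∈ Finset.range n, harmonicSum i * ((i : ℝ) + 1)⁻¹)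
      atTop atTop := by
    have h2 : Tendsto (fun n => harmonicSum n ^ 2) atTop atTop :=
      (tendsto_pow_atTop two_ne_zero).comp tendsto_harmonicSum_atTop
    refine (tendsto_sum_harmonicSum_mul_inv_div.pos_mul_atTop (by norm_num) h2).congr' ?_
    filter_upwards [hpos] with n hn
    field_simp
  have hs := (ho.sum_range (fun n => mul_nonneg (harmonicSum_nonneg n) (by positivity))
    hdiv).tendsto_div_nhds_zero
  have hs2 := (hs.mul tendsto_sum_harmonicSum_mul_inv_div).add
    (tendsto_sum_harmonicSum_mul_inv_div.const_mul κ)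
  -- The boundary term contributes `κ` and the Abel sum `κ / 2`.
  have hfin := h.sub hs2
  rw [show κ - (0 * (1 / 2) + κ * (1 / 2)) = κ / 2 by ring] at hfin
  refine hfin.congr' ?_
  filter_upwards [hpos, hdiv.eventually_gt_atTop 0] with n hn hd
  rw [sum_mul_harmonicSum]
  change A n / _ - _ = (A n * _ - ∑ i ∈ Finset.range n, A i * _) / _
  have e : ∑ i ∈ Finset.range n, (A i - κ * harmonicSum i) * ((i : ℝ) + 1)⁻¹ =
      ∑ i ∈ Finset.range n, A i * ((i : ℝ) + 1)⁻¹ -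
        κ * ∑ i ∈ Finset.range n, harmonicSum i * ((i : ℝ) + 1)⁻¹ := by
    rw [Finset.mul_sum, ← Finset.sum_sub_distrib]
    exact Finset.sum_congr rfl fun _ _ => by ring
  rw [e]
  generalize ∑ i ∈ Finset.range n, harmonicSum i * ((i : ℝ) + 1)⁻¹ = S at hd ⊢
  generalize ∑ i ∈ Finset.range n, A i * ((i : ℝ) + 1)⁻¹ = U
  generalize A n = W
  field_simp
  ring

/-! ### A mean value inequality with countably many exceptions -/

theorem frequently_nhdsGT_notMem {C : Set ℝ} (hC : C.Countable) (x : ℝ) :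
    ∃ᶠ t in 𝓝[>] x, t ∉ C := by
  rw [frequently_iff]
  intro U hU
  obtain ⟨b, hb, hbU⟩ := mem_nhdsGT_iff_exists_Ioo_subset.1 hU
  obtain ⟨t, ht, hxt⟩ := (hC.dense_compl ℝ).exists_between hb
  exact ⟨t, hbU hxt, ht⟩

/-- An intermediate value property for functions with one-sided limits: a value between `h x` and
`h y` is attained outside the countable set `C`, or lies in the gap of a jump. -/
theorem Ioo_subset_image_union_gaps {h l r : ℝ → ℝ} {C : Set ℝ} (hC : C.Countable)
    (hl : ∀ t, Tendsto h (𝓝[<] t) (𝓝 (l t))) (hr : ∀ t, Tendsto h (𝓝[>] t) (𝓝 (r t)))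
    (hcont : ∀ t ∉ C, ContinuousAt h t) {x y : ℝ} (hxy : x ≤ y) (hx : x ∉ C) (hy : y ∉ C) :
    Ioo (h x) (h y) ⊆ h '' (Icc x y \ C) ∪ ⋃ c ∈ C ∩ Ioo x y, Icc (l c) (r c) := by
  intro v hv
  -- At the supremum `T` of `S`, `h` is below `v` at points approaching `T` and at least `v` at
  -- points off `C` just to the right. If `T ∈ C`, the one-sided limits enclose `v`; otherwise
  -- continuity forces `h T = v`.
  set S : Set ℝ := {t | t ∈ Icc x y ∧ t ∉ C ∧ h t < v} with hS
  have hxS : x ∈ S := ⟨⟨le_rfl, hxy⟩, hx, hv.1⟩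
  have hbdd : BddAbove S := ⟨y, fun t ht => ht.1.2⟩
  set T := sSup S with hT
  have hlub : IsLUB S T := isLUB_csSup ⟨x, hxS⟩ hbdd
  have hxT : x ≤ T := hlub.1 hxS
  have hTy : T ≤ y := hlub.2 fun t ht => ht.1.2
  have hright : T < y → ∃ᶠ t in 𝓝[>] T, v ≤ h t := fun hlt => by
    refine ((frequently_nhdsGT_notMem hC T).and_eventually
      (Ioo_mem_nhdsGT hlt)).mono fun t ht => ?_
    by_contra hcon
    push Not at hcon
    exact absurd (hlub.1 (show t ∈ S from ⟨⟨hxT.trans ht.2.1.le, ht.2.2.le⟩, ht.1, hcon⟩))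
      (not_le.2 ht.2.1)
  have hclos : T ∈ closure S := hlub.mem_closure ⟨x, hxS⟩
  by_cases hTC : T ∈ C
  · right
    have hTx : x < T := lt_of_le_of_ne hxT fun e => hx (e ▸ hTC)
    have hTy' : T < y := lt_of_le_of_ne hTy fun e => hy (e ▸ hTC)
    refine mem_biUnion (x := T) ⟨hTC, hTx, hTy'⟩ ⟨?_, ?_⟩
    · refine le_of_tendsto_of_frequently (hl T) ?_
      rw [frequently_iff]
      intro U hU
      obtain ⟨b, hb, hbU⟩ := mem_nhdsLT_iff_exists_Ioo_subset.1 hU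
      obtain ⟨t, ht, hbt, htT⟩ := hlub.exists_between hb
      have htT' : t < T := lt_of_le_of_ne htT fun e => ht.2.1 (e ▸ hTC)
      exact ⟨t, hbU ⟨hbt, htT'⟩, ht.2.2.le⟩
    · exact ge_of_tendsto_of_frequently (hr T) (hright hTy')
  · left
    refine ⟨T, ⟨⟨hxT, hTy⟩, hTC⟩, le_antisymm ?_ ?_⟩
    · refine le_of_tendsto_of_frequently (hcont T hTC).tendsto ?_
      exact (mem_closure_iff_frequently.1 hclos).mono fun t ht => ht.2.2.le
    · rcases hTy.eq_or_lt with e | hlt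
      · rw [e]; exact hv.2.le
      · exact ge_of_tendsto_of_frequently
          ((hcont T hTC).tendsto.mono_left nhdsWithin_le_nhds) (hright hlt)

/-- The interval from `h x` to `h y` is covered by the image of the good points, of measure at most
`M * (y - x)` by the derivative bound, and by countably many gaps. Comparing Lebesgue measures gives
the inequality, with no absolute continuity needed. -/
theorem ofReal_sub_le_of_jumps {h l r : ℝ → ℝ} {C : Set ℝ} (hC : C.Countable)
    (hl : ∀ t, Tendsto h (𝓝[<] t) (𝓝 (l t))) (hr : ∀ t, Tendsto h (𝓝[>] t) (𝓝 (r t)))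
    {h' : ℝ → ℝ} {M : ℝ} (hM : 0 ≤ M) (hd : ∀ t ∉ C, HasDerivAt h (h' t) t)
    (hb : ∀ t ∉ C, |h' t| ≤ M) {x y : ℝ} (hxy : x ≤ y) (hx : x ∉ C) (hy : y ∉ C) :
    ENNReal.ofReal (h y - h x) ≤ ENNReal.ofReal (M * (y - x)) +
      ∑' c : ↥(C ∩ Ioo x y), ENNReal.ofReal |r c - l c| := by
  have hcount : (C ∩ Ioo x y).Countable := hC.mono inter_subset_left
  have : Countable ↥(C ∩ Ioo x y) := hcount.to_subtype
  have hmeas : MeasurableSet (Icc x y \ C) := measurableSet_Icc.diff hC.measurableSet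
  rw [← Real.volume_Ioo]
  refine (measure_mono (Ioo_subset_image_union_gaps hC hl hr
    (fun t ht => (hd t ht).continuousAt) hxy hx hy)).trans ?_
  refine (measure_union_le _ _).trans (add_le_add ?_ ?_)
  · have h1 := addHaar_image_le_lintegral_abs_det_fderiv volume hmeas
      (fun t ht => (hd t ht.2).hasFDerivAt.hasFDerivWithinAt (s := Icc x y \ C))
    simp only [ContinuousLinearMap.det_toSpanSingleton] at h1
    refine h1.trans ?_
    calc _ ≤ ∫⁻ _ in Icc x y \ C, ENNReal.ofReal M :=
          setLIntegral_mono measurable_const fun t ht => ENNReal.ofReal_le_ofReal (hb t ht.2)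
      _ = ENNReal.ofReal M * volume (Icc x y \ C) := by simp
      _ ≤ ENNReal.ofReal M * volume (Icc x y) := by gcongr; exact sdiff_subset
      _ = _ := by rw [Real.volume_Icc, ENNReal.ofReal_mul hM]
  · rw [biUnion_eq_iUnion]
    refine (measure_iUnion_le _).trans (ENNReal.tsum_le_tsum fun c => ?_)
    rw [Real.volume_Icc]
    exact ENNReal.ofReal_le_ofReal (le_abs_self _)

/-- The mean value inequality for a function with countably many jumps. -/
theorem ofReal_abs_sub_le_of_jumps {h l r : ℝ → ℝ} {C : Set ℝ} (hC : C.Countable)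
    (hl : ∀ t, Tendsto h (𝓝[<] t) (𝓝 (l t))) (hr : ∀ t, Tendsto h (𝓝[>] t) (𝓝 (r t)))
    {h' : ℝ → ℝ} {M : ℝ} (hM : 0 ≤ M) (hd : ∀ t ∉ C, HasDerivAt h (h' t) t)
    (hb : ∀ t ∉ C, |h' t| ≤ M) {x y : ℝ} (hxy : x ≤ y) (hx : x ∉ C) (hy : y ∉ C) :
    ENNReal.ofReal |h y - h x| ≤ ENNReal.ofReal (M * (y - x)) +
      ∑' c : ↥(C ∩ Ioo x y), ENNReal.ofReal |r c - l c| := by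
  rcases abs_choice (h y - h x) with e | e
  · rw [e]
    exact ofReal_sub_le_of_jumps hC hl hr hM hd hb hxy hx hy
  · have := ofReal_sub_le_of_jumps hC (fun t => (hl t).neg) (fun t => (hr t).neg) hM
      (fun t ht => (hd t ht).neg) (fun t ht => by rw [abs_neg]; exact hb t ht) hxy hx hy
    rw [e]
    convert this using 2
    · simp; ring
    · refine tsum_congr fun c => ?_
      rw [← abs_neg]
      congr 2
      ring

/-! ### The sawtooth function -/

/-- The sawtooth of period `2π`, with jump `1` at the multiples of `2π`. -/
noncomputable def sawtooth (x : ℝ) : ℝ := -Int.fract (x / (2 * Real.pi))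

theorem sawtooth_periodic : Function.Periodic sawtooth (2 * Real.pi) := fun x => by
  have h0 : (2 * Real.pi) ≠ 0 := Real.two_pi_pos.ne'
  rw [sawtooth, add_div, div_self h0, Int.fract_add_one, sawtooth]

theorem sawtooth_eq {x : ℝ} (hx : x ∈ Ico 0 (2 * Real.pi)) : sawtooth x = -(x / (2 * Real.pi)) := by
  rw [sawtooth, Int.fract_eq_self.2 ⟨by have := hx.1; positivity, (div_lt_one Real.two_pi_pos).2 hx.2⟩]

theorem abs_sawtooth_le (x : ℝ) : |sawtooth x| ≤ 1 := by
  rw [sawtooth, abs_neg, Int.abs_fract]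
  exact (Int.fract_lt_one _).le

theorem measurable_sawtooth : Measurable sawtooth :=
  (measurable_fract.comp (measurable_id.div_const _)).neg

/-- The left limit of the sawtooth. -/
noncomputable def sawtoothLeft (x : ℝ) : ℝ := ⌈x / (2 * Real.pi)⌉ - 1 - x / (2 * Real.pi)

theorem tendsto_sawtooth_right (x : ℝ) : Tendsto sawtooth (𝓝[>] x) (𝓝 (sawtooth x)) := by
  have hpos := Real.two_pi_pos
  have h1 : Tendsto (fun y => (⌊x / (2 * Real.pi)⌋ : ℝ) - y / (2 * Real.pi)) (𝓝[>] x)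
      (𝓝 (⌊x / (2 * Real.pi)⌋ - x / (2 * Real.pi))) :=
    (Continuous.tendsto (by fun_prop) x).mono_left nhdsWithin_le_nhds
  have e : sawtooth x = ⌊x / (2 * Real.pi)⌋ - x / (2 * Real.pi) := by
    rw [sawtooth, Int.fract]; ring
  rw [e]
  refine h1.congr' ?_
  have hlt : x < (⌊x / (2 * Real.pi)⌋ + 1) * (2 * Real.pi) := by
    rw [← div_lt_iff₀ hpos]; exact Int.lt_floor_add_one _
  filter_upwards [Ioo_mem_nhdsGT hlt] with y hy
  have : ⌊y / (2 * Real.pi)⌋ = ⌊x / (2 * Real.pi)⌋ := by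
    rw [Int.floor_eq_iff]
    refine ⟨(Int.floor_le _).trans ?_, by rw [div_lt_iff₀ hpos]; exact hy.2⟩
    have := hy.1.le
    gcongr
  rw [sawtooth, Int.fract, this]; ring

theorem sawtooth_eq_of_mem_Ioo {x y : ℝ}
    (hy : y ∈ Ioo ((⌈x / (2 * Real.pi)⌉ - 1 : ℝ) * (2 * Real.pi)) ((⌈x / (2 * Real.pi)⌉ : ℝ) * (2 * Real.pi))) :
    sawtooth y = ⌈x / (2 * Real.pi)⌉ - 1 - y / (2 * Real.pi) := by
  have hpos := Real.two_pi_pos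
  have : ⌊y / (2 * Real.pi)⌋ = ⌈x / (2 * Real.pi)⌉ - 1 := by
    rw [Int.floor_eq_iff]
    push_cast
    refine ⟨by rw [le_div_iff₀ hpos]; exact hy.1.le, ?_⟩
    rw [div_lt_iff₀ hpos, sub_add_cancel]
    exact hy.2
  rw [sawtooth, Int.fract, this]; push_cast; ring

theorem tendsto_sawtooth_left (x : ℝ) : Tendsto sawtooth (𝓝[<] x) (𝓝 (sawtoothLeft x)) := by
  have hpos := Real.two_pi_pos
  have h1 : Tendsto (fun y => (⌈x / (2 * Real.pi)⌉ : ℝ) - 1 - y / (2 * Real.pi)) (𝓝[<] x)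
      (𝓝 (sawtoothLeft x)) :=
    (Continuous.tendsto (by fun_prop) x).mono_left nhdsWithin_le_nhds
  refine h1.congr' ?_
  have hlt : (⌈x / (2 * Real.pi)⌉ - 1 : ℝ) * (2 * Real.pi) < x := by
    rw [← lt_div_iff₀ hpos]; linarith [Int.ceil_lt_add_one (x / (2 * Real.pi))]
  have hle : x ≤ (⌈x / (2 * Real.pi)⌉ : ℝ) * (2 * Real.pi) := by
    rw [← div_le_iff₀ hpos]; exact Int.le_ceil _
  filter_upwards [Ioo_mem_nhdsLT hlt] with y hy
  exact (sawtooth_eq_of_mem_Ioo ⟨hy.1, hy.2.trans_le hle⟩).symm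

theorem sawtooth_sub_sawtoothLeft (x : ℝ) [Decidable (∃ k : ℤ, x = k * (2 * Real.pi))] :
    sawtooth x - sawtoothLeft x = if ∃ k : ℤ, x = k * (2 * Real.pi) then 1 else 0 := by
  have hpos := Real.two_pi_pos
  rw [sawtooth, sawtoothLeft, Int.fract]
  split_ifs with h
  · obtain ⟨k, rfl⟩ := h
    rw [mul_div_cancel_right₀ _ hpos.ne', Int.floor_intCast, Int.ceil_intCast]
    ring
  · have : ⌈x / (2 * Real.pi)⌉ = ⌊x / (2 * Real.pi)⌋ + 1 := by
      rw [Int.ceil_eq_iff]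
      push_cast
      refine ⟨?_, (Int.lt_floor_add_one _).le⟩
      rw [add_sub_cancel_right]
      refine lt_of_le_of_ne (Int.floor_le _) fun e => h ⟨⌊x / (2 * Real.pi)⌋, ?_⟩
      rw [e, div_mul_cancel₀ _ hpos.ne']
    rw [this]; push_cast; ring

theorem hasDerivAt_sawtooth {x : ℝ} (hx : ¬ ∃ k : ℤ, x = k * (2 * Real.pi)) :
    HasDerivAt sawtooth (-(1 / (2 * Real.pi))) x := by
  have hpos := Real.two_pi_pos
  have hlt : (⌈x / (2 * Real.pi)⌉ - 1 : ℝ) * (2 * Real.pi) < x := by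
    rw [← lt_div_iff₀ hpos]; linarith [Int.ceil_lt_add_one (x / (2 * Real.pi))]
  have hle : x < (⌈x / (2 * Real.pi)⌉ : ℝ) * (2 * Real.pi) := by
    refine lt_of_le_of_ne ?_ fun e => hx ⟨_, e⟩
    rw [← div_le_iff₀ hpos]; exact Int.le_ceil _
  have h1 : HasDerivAt (fun y => (⌈x / (2 * Real.pi)⌉ : ℝ) - 1 - y / (2 * Real.pi))
      (-(1 / (2 * Real.pi))) x := ((hasDerivAt_id x).div_const _).const_sub _
  refine h1.congr_of_eventuallyEq ?_
  filter_upwards [Ioo_mem_nhds hlt hle] with y hy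
  exact sawtooth_eq_of_mem_Ioo hy

/-! ### One-sided limits and jumps of a periodic function of bounded variation -/

section OneSidedLimits

variable {f : ℝ → ℝ}

theorem periodic_int (hf : Function.Periodic f (2 * Real.pi)) (k : ℤ) (x : ℝ) :
    f (x + k * (2 * Real.pi)) = f x := hf.int_mul k x

theorem tendsto_leftLim_of_periodic (hf : Function.Periodic f (2 * Real.pi))
    (hbv : BoundedVariationOn f (Icc 0 (2 * Real.pi))) (x : ℝ) :
    Tendsto f (𝓝[<] x) (𝓝 (Function.leftLim f x)) := by
  refine tendsto_leftLim_of_tendsto ?_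
  -- A half-open period closed on the right keeps a whole left neighbourhood of the translated point
  -- inside `[0, 2π]`; for right limits the other half-open period is used.
  obtain ⟨k, hk, -⟩ := existsUnique_add_zsmul_mem_Ioc Real.two_pi_pos x 0
  rw [zero_add, zsmul_eq_mul] at hk
  obtain ⟨l, hl⟩ := hbv.exists_tendsto_left (x + k * (2 * Real.pi))
  refine ⟨l, ?_⟩
  have h1 : Tendsto f (𝓝[<] (x + k * (2 * Real.pi))) (𝓝 l) := by
    refine hl.mono_left (le_inf nhdsWithin_le_nhds ?_)
    rw [le_principal_iff]
    filter_upwards [Ioo_mem_nhdsLT hk.1] with y hy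
    exact ⟨⟨hy.1.le, hy.2.le.trans hk.2⟩, hy.2⟩
  have h2 : Tendsto (fun y => y + k * (2 * Real.pi)) (𝓝[<] x) (𝓝[<] (x + k * (2 * Real.pi))) := by
    refine tendsto_nhdsWithin_of_tendsto_nhds_of_eventually_within _
      ((Continuous.tendsto (by fun_prop) x).mono_left nhdsWithin_le_nhds) ?_
    filter_upwards [self_mem_nhdsWithin] with y hy
    exact add_lt_add_left (mem_Iio.1 hy) _
  exact (h1.comp h2).congr fun y => periodic_int hf k y

theorem tendsto_rightLim_of_periodic (hf : Function.Periodic f (2 * Real.pi))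
    (hbv : BoundedVariationOn f (Icc 0 (2 * Real.pi))) (x : ℝ) :
    Tendsto f (𝓝[>] x) (𝓝 (Function.rightLim f x)) := by
  refine tendsto_rightLim_of_tendsto ?_
  obtain ⟨k, hk, -⟩ := existsUnique_add_zsmul_mem_Ico Real.two_pi_pos x 0
  rw [zero_add, zsmul_eq_mul] at hk
  obtain ⟨l, hl⟩ := hbv.exists_tendsto_right (x + k * (2 * Real.pi))
  refine ⟨l, ?_⟩
  have h1 : Tendsto f (𝓝[>] (x + k * (2 * Real.pi))) (𝓝 l) := by
    refine hl.mono_left (le_inf nhdsWithin_le_nhds ?_)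
    rw [le_principal_iff]
    filter_upwards [Ioo_mem_nhdsGT hk.2] with y hy
    exact ⟨⟨hk.1.trans hy.1.le, hy.2.le⟩, hy.1⟩
  have h2 : Tendsto (fun y => y + k * (2 * Real.pi)) (𝓝[>] x) (𝓝[>] (x + k * (2 * Real.pi))) := by
    refine tendsto_nhdsWithin_of_tendsto_nhds_of_eventually_within _
      ((Continuous.tendsto (by fun_prop) x).mono_left nhdsWithin_le_nhds) ?_
    filter_upwards [self_mem_nhdsWithin] with y hy
    exact add_lt_add_left (mem_Ioi.1 hy) _
  exact (h1.comp h2).congr fun y => periodic_int hf k y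

theorem leftLim_add_int (hf : Function.Periodic f (2 * Real.pi))
    (hbv : BoundedVariationOn f (Icc 0 (2 * Real.pi))) (k : ℤ) (x : ℝ) :
    Function.leftLim f (x + k * (2 * Real.pi)) = Function.leftLim f x := by
  refine leftLim_eq_of_tendsto ?_
  have h2 : Tendsto (fun y => y + (-k : ℤ) * (2 * Real.pi)) (𝓝[<] (x + k * (2 * Real.pi)))
      (𝓝[<] x) := by
    refine tendsto_nhdsWithin_of_tendsto_nhds_of_eventually_within _
      (((Continuous.tendsto' (by fun_prop) _ _ (by push_cast; ring))).mono_left nhdsWithin_le_nhds) ?_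
    filter_upwards [self_mem_nhdsWithin] with y hy
    rw [mem_Iio] at hy ⊢
    push_cast
    linarith
  exact ((tendsto_leftLim_of_periodic hf hbv x).comp h2).congr fun y => periodic_int hf _ y

theorem rightLim_add_int (hf : Function.Periodic f (2 * Real.pi))
    (hbv : BoundedVariationOn f (Icc 0 (2 * Real.pi))) (k : ℤ) (x : ℝ) :
    Function.rightLim f (x + k * (2 * Real.pi)) = Function.rightLim f x := by
  refine rightLim_eq_of_tendsto ?_
  have h2 : Tendsto (fun y => y + (-k : ℤ) * (2 * Real.pi)) (𝓝[>] (x + k * (2 * Real.pi)))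
      (𝓝[>] x) := by
    refine tendsto_nhdsWithin_of_tendsto_nhds_of_eventually_within _
      (((Continuous.tendsto' (by fun_prop) _ _ (by push_cast; ring))).mono_left nhdsWithin_le_nhds) ?_
    filter_upwards [self_mem_nhdsWithin] with y hy
    rw [mem_Ioi] at hy ⊢
    push_cast
    linarith
  exact ((tendsto_rightLim_of_periodic hf hbv x).comp h2).congr fun y => periodic_int hf _ y

theorem jump_add_int (hf : Function.Periodic f (2 * Real.pi))
    (hbv : BoundedVariationOn f (Icc 0 (2 * Real.pi))) (k : ℤ) (x : ℝ) :
    jump f (x + k * (2 * Real.pi)) = jump f x := by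
  rw [jump, leftLim_add_int hf hbv, rightLim_add_int hf hbv, jump]

theorem jump_eq_zero_of_continuousAt {x : ℝ} (h : ContinuousAt f x) : jump f x = 0 := by
  rw [jump, h.continuousWithinAt.leftLim_eq, h.continuousWithinAt.rightLim_eq, sub_self]

theorem ofReal_abs_jump_le_eVariationOn (hf : Function.Periodic f (2 * Real.pi))
    (hbv : BoundedVariationOn f (Icc 0 (2 * Real.pi))) {z c z' : ℝ} (hz : z < c) (hz' : c < z') :
    ENNReal.ofReal |jump f c| ≤ eVariationOn f (Ioo z z') := by
  rw [← Real.enorm_eq_ofReal_abs, jump, ← edist_eq_enorm_sub]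
  have hl := tendsto_leftLim_of_periodic hf hbv c
  have hr := tendsto_rightLim_of_periodic hf hbv c
  refine le_of_tendsto (Filter.Tendsto.edist (hr.comp tendsto_fst) (hl.comp tendsto_snd)) ?_
  filter_upwards [prod_mem_prod (Ioo_mem_nhdsGT hz') (Ioo_mem_nhdsLT hz)] with p hp
  exact eVariationOn.edist_le f ⟨hz.trans hp.1.1, hp.1.2⟩ ⟨hp.2.1, hp.2.2.trans hz'⟩

theorem summable_jump (hf : Function.Periodic f (2 * Real.pi))
    (hbv : BoundedVariationOn f (Icc 0 (2 * Real.pi))) :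
    Summable fun x : jumpSet f => |jump f x| := by
  refine summable_of_sum_le (c := (eVariationOn f (Ioo 0 (2 * Real.pi))).toReal)
    (fun _ => abs_nonneg _) fun u => ?_
  have h := sum_le_eVariationOn_Ioo (f := f) (g := fun c => ENNReal.ofReal |jump f c|)
    (fun _ _ _ h h' => ofReal_abs_jump_le_eVariationOn hf hbv h h')
    (u.map (Function.Embedding.subtype _)) 0 (2 * Real.pi) (by
      intro c hc
      obtain ⟨j, -, rfl⟩ := Finset.mem_map.1 hc
      exact j.2.1)
  rw [Finset.sum_map, ← ENNReal.ofReal_sum_of_nonneg fun _ _ => abs_nonneg _] at h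
  exact (ENNReal.ofReal_le_iff_le_toReal (hbv.mono Ioo_subset_Icc_self)).1 h

end OneSidedLimits

/-! ### Increments of `f` after finitely many jumps are removed -/

/-- The part of `f` left when the jumps at the points of `F` are taken away. -/
noncomputable def jumpRemainder (f : ℝ → ℝ) (F : Finset (jumpSet f)) (x : ℝ) : ℝ :=
  f x - ∑ j ∈ F, jump f j * sawtooth (x - j)

section Remainder

variable {f : ℝ → ℝ}

theorem tsum_ite_subsingleton_le {α : Type*} (P : α → Prop) [DecidablePred P]
    (hP : ∀ a b, P a → P b → a = b) (w : ENNReal) : ∑' a, (if P a then w else 0) ≤ w := by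
  by_cases h : ∃ a, P a
  · obtain ⟨a, ha⟩ := h
    rw [tsum_eq_single a fun b hb => if_neg fun hPb => hb (hP b a hPb ha), if_pos ha]
  · push Not at h
    simp [h]

theorem tendsto_comp_sub_right {g : ℝ → ℝ} {l : Filter ℝ} {c x : ℝ}
    (h : Tendsto g (𝓝[>] (x - c)) l) : Tendsto (fun y => g (y - c)) (𝓝[>] x) l := by
  refine h.comp (tendsto_nhdsWithin_of_tendsto_nhds_of_eventually_within _
    ((Continuous.tendsto (by fun_prop) x).mono_left nhdsWithin_le_nhds) ?_)
  filter_upwards [self_mem_nhdsWithin] with y hy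
  exact sub_lt_sub_right hy c

theorem tendsto_comp_sub_left {g : ℝ → ℝ} {l : Filter ℝ} {c x : ℝ}
    (h : Tendsto g (𝓝[<] (x - c)) l) : Tendsto (fun y => g (y - c)) (𝓝[<] x) l := by
  refine h.comp (tendsto_nhdsWithin_of_tendsto_nhds_of_eventually_within _
    ((Continuous.tendsto (by fun_prop) x).mono_left nhdsWithin_le_nhds) ?_)
  filter_upwards [self_mem_nhdsWithin] with y hy
  exact sub_lt_sub_right hy c

theorem eq_of_sub_eq_int_mul {x y : ℝ} (h : |x - y| < 2 * Real.pi) {k : ℤ}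
    (hk : x - y = k * (2 * Real.pi)) : x = y := by
  have hpos := Real.two_pi_pos
  rw [hk, abs_mul, abs_of_pos hpos] at h
  have h1 : |(k : ℝ)| < 1 := by
    by_contra hcon
    push Not at hcon
    nlinarith
  have h2 : k = 0 := by
    rw [← Int.abs_lt_one_iff]
    exact_mod_cast h1
  rw [h2] at hk
  push_cast at hk
  linarith

-- A point is congruent to at most one point of `jumpSet f`, so the remainder has jump `0` there or
-- a jump of `f` outside `F`. The points congruent to `0`, which `jumpSet f` omits, are covered by
-- `h0`. The bound is written as a sum over `j` so that it can later be exchanged with a sum over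
-- `c`.
open Classical in
theorem ofReal_abs_jump_remainder_le (hf : Function.Periodic f (2 * Real.pi))
    (hbv : BoundedVariationOn f (Icc 0 (2 * Real.pi))) (h0 : jump f 0 = 0)
    (F : Finset (jumpSet f)) (c : ℝ) :
    ENNReal.ofReal |jump f c -
        ∑ j ∈ F, jump f j * (sawtooth (c - j) - sawtoothLeft (c - j))| ≤
      ∑' j : jumpSet f, if ∃ k : ℤ, c - j = k * (2 * Real.pi) then
        ENNReal.ofReal (if j ∈ F then 0 else |jump f j|) else 0 := by
  simp_rw [sawtooth_sub_sawtoothLeft]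
  by_cases h : ∃ j : jumpSet f, ∃ k : ℤ, c - j = k * (2 * Real.pi)
  · obtain ⟨j, k, hk⟩ := h
    refine le_trans ?_ (ENNReal.le_tsum j)
    rw [if_pos ⟨k, hk⟩]
    have hc : jump f c = jump f j := by
      rw [← jump_add_int hf hbv k j]; congr 1; linarith
    have huniq : ∀ i ∈ F, i ≠ j → jump f i *
        (if ∃ k : ℤ, c - i = k * (2 * Real.pi) then 1 else 0) = 0 := by
      intro i _ hij
      rw [if_neg, mul_zero]
      rintro ⟨k', hk'⟩
      refine hij (Subtype.ext (eq_of_sub_eq_int_mul (k := k - k') ?_ ?_))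
      · rw [abs_sub_lt_iff]
        exact ⟨by linarith [i.2.1.2, j.2.1.1], by linarith [j.2.1.2, i.2.1.1]⟩
      · push_cast; linarith
    refine ENNReal.ofReal_le_ofReal ?_
    by_cases hj : j ∈ F
    · rw [Finset.sum_eq_single_of_mem j hj huniq, if_pos ⟨k, hk⟩, if_pos hj, hc, mul_one, sub_self,
        abs_zero]
    · rw [Finset.sum_eq_zero fun i hi => huniq i hi fun e => hj (e ▸ hi), if_neg hj, hc, sub_zero]
  · push Not at h
    obtain ⟨k, hk, -⟩ := existsUnique_add_zsmul_mem_Ico Real.two_pi_pos c 0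
    rw [zero_add, zsmul_eq_mul] at hk
    have hc : jump f c = 0 := by
      rw [← jump_add_int hf hbv k c]
      by_contra hne
      rcases hk.1.eq_or_lt with e | hlt
      · exact hne (e ▸ h0)
      · refine h ⟨_, ⟨hlt, hk.2⟩, hne⟩ (-k) ?_
        push_cast; ring
    have : ∑ j ∈ F, jump f j * (if ∃ k : ℤ, c - j = k * (2 * Real.pi) then (1 : ℝ) else 0) = 0 :=
      Finset.sum_eq_zero fun j _ => by
        rw [if_neg, mul_zero]
        rintro ⟨k, hk⟩
        exact h j k hk
    rw [hc, this]
    simp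

/-- The derivative of a function with `HasBVDeriv` is bounded outside a countable periodic set. -/
theorem exists_bound_deriv (hf : Function.Periodic f (2 * Real.pi)) (hd : HasBVDeriv f) :
    ∃ C : Set ℝ, C.Countable ∧ (∀ x, ∀ k : ℤ, x + k * (2 * Real.pi) ∈ C → x ∈ C) ∧
      (∀ x ∉ C, DifferentiableAt ℝ f x) ∧ ∃ M, 0 ≤ M ∧ ∀ x ∉ C, |deriv f x| ≤ M := by
  obtain ⟨C₀, hC₀, hdiff, hbv⟩ := hd
  -- All translates of the exceptional set are removed, since the derivative is controlled on one
  -- period only and the bound is carried elsewhere by periodicity.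
  refine ⟨⋃ k : ℤ, (fun x => x + k * (2 * Real.pi)) ⁻¹' C₀, ?_, ?_, ?_, ?_⟩
  · exact countable_iUnion fun k => hC₀.preimage (add_left_injective _)
  · intro x k hx
    obtain ⟨m, hm⟩ := mem_iUnion.1 hx
    refine mem_iUnion.2 ⟨k + m, ?_⟩
    rw [mem_preimage] at hm ⊢
    convert hm using 1
    push_cast; ring
  · intro x hx
    refine hdiff x fun h => hx (mem_iUnion.2 ⟨0, by simpa using h⟩)
  · obtain ⟨M, hM⟩ : ∃ M, ∀ x ∈ Icc 0 (2 * Real.pi) \ C₀, |deriv f x| ≤ M := by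
      rcases (Icc 0 (2 * Real.pi) \ C₀).eq_empty_or_nonempty with he | ⟨s, hs⟩
      · exact ⟨0, fun x hx => by rw [he] at hx; exact hx.elim⟩
      · refine ⟨|deriv f s| + (eVariationOn (deriv f) (Icc 0 (2 * Real.pi) \ C₀)).toReal,
          fun x hx => ?_⟩
        have := hbv.dist_le hx hs
        rw [Real.dist_eq] at this
        linarith [abs_sub_abs_le_abs_sub (deriv f x) (deriv f s)]
    refine ⟨max M 0, le_max_right _ _, fun x hx => ?_⟩
    obtain ⟨k, hk, -⟩ := existsUnique_add_zsmul_mem_Ico Real.two_pi_pos x 0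
    rw [zero_add, zsmul_eq_mul] at hk
    have hper : deriv f (x + k * (2 * Real.pi)) = deriv f x := by
      rw [← deriv_comp_add_const]
      congr 1
      exact funext fun y => periodic_int hf k y
    rw [← hper]
    exact (hM _ ⟨⟨hk.1, hk.2.le⟩, fun h => hx (mem_iUnion.2 ⟨k, h⟩)⟩).trans (le_max_left _ _)

theorem tsum_ite_mem_eq {ι : Type*} [DecidableEq ι] {g : ι → ℝ} (hg : Summable g) (F : Finset ι) :
    Summable (fun j => if j ∈ F then 0 else g j) ∧
      ∑' j, (if j ∈ F then 0 else g j) = ∑' j, g j - ∑ j ∈ F, g j := by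
  have h1 : HasSum (fun j => if j ∈ F then g j else 0) (∑ j ∈ F, g j) := by
    have : HasSum (fun j => if j ∈ F then g j else 0) (∑ j ∈ F, if j ∈ F then g j else 0) :=
      hasSum_sum_of_ne_finset_zero fun j hj => if_neg hj
    rwa [Finset.sum_congr rfl fun j hj => if_pos hj] at this
  have h2 := hg.hasSum.sub h1
  have e : (fun j => g j - if j ∈ F then g j else 0) = fun j => if j ∈ F then 0 else g j := by
    ext j; split_ifs <;> simp
  rw [e] at h2
  exact ⟨h2.summable, h2.tsum_eq⟩

/-- This is the mean value inequality for the remainder. The Lipschitz constant does not depend on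
`F`, and the additive error is the tail of the jump series, which disappears as `F` grows. The
restriction `y - x < 2π` ensures that each jump is met at most once modulo `2π`. -/
theorem exists_remainder_lipschitz (hf : Function.Periodic f (2 * Real.pi))
    (hbv : BoundedVariationOn f (Icc 0 (2 * Real.pi))) (hd : HasBVDeriv f) (h0 : jump f 0 = 0) :
    ∃ C : Set ℝ, C.Countable ∧ ∃ M : ℝ, 0 ≤ M ∧ ∀ F : Finset (jumpSet f), ∀ x ∉ C, ∀ y ∉ C,
      x ≤ y → y - x < 2 * Real.pi → |jumpRemainder f F y - jumpRemainder f F x| ≤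
        M * (y - x) + (∑' j : jumpSet f, |jump f j| - ∑ j ∈ F, |jump f j|) := by
  classical
  obtain ⟨C, hC, hCper, hdiff, M, hM0, hM⟩ := exists_bound_deriv hf hd
  have hsum := summable_jump hf hbv
  have hpos := Real.two_pi_pos
  -- `M` bounds the derivative of `f`; each sawtooth has slope `-1/(2π)`, so together they add at
  -- most `∑ |J|`.
  refine ⟨C, hC, M + ∑' j : jumpSet f, |jump f j|, add_nonneg hM0 (tsum_nonneg fun _ => abs_nonneg _),
    fun F x hx y hy hxy hlt => ?_⟩
  have hl : ∀ t, Tendsto (jumpRemainder f F) (𝓝[<] t)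
      (𝓝 (Function.leftLim f t - ∑ j ∈ F, jump f j * sawtoothLeft (t - j))) := fun t =>
    (tendsto_leftLim_of_periodic hf hbv t).sub (tendsto_finsetSum _ fun j _ =>
      (tendsto_comp_sub_left (tendsto_sawtooth_left (t - j))).const_mul _)
  have hr : ∀ t, Tendsto (jumpRemainder f F) (𝓝[>] t)
      (𝓝 (Function.rightLim f t - ∑ j ∈ F, jump f j * sawtooth (t - j))) := fun t =>
    (tendsto_rightLim_of_periodic hf hbv t).sub (tendsto_finsetSum _ fun j _ =>
      (tendsto_comp_sub_right (tendsto_sawtooth_right (t - j))).const_mul _)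
  have hder : ∀ t ∉ C, HasDerivAt (jumpRemainder f F)
      (deriv f t - ∑ j ∈ F, jump f j * (-(1 / (2 * Real.pi)))) t := fun t ht => by
    refine (hdiff t ht).hasDerivAt.sub (HasDerivAt.fun_sum fun j _ => ?_)
    refine HasDerivAt.const_mul _ (HasDerivAt.comp_sub_const t j (hasDerivAt_sawtooth ?_))
    rintro ⟨k, hk⟩
    refine ht (hCper t (-k) ?_)
    by_contra hj
    refine j.2.2 (jump_eq_zero_of_continuousAt (hdiff _ ?_).continuousAt)
    have e : (j : ℝ) = t + (-k : ℤ) * (2 * Real.pi) := by push_cast; linarith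
    rwa [e]
  have hb : ∀ t ∉ C, |deriv f t - ∑ j ∈ F, jump f j * (-(1 / (2 * Real.pi)))| ≤
      M + ∑' j : jumpSet f, |jump f j| := fun t ht => by
    refine (abs_sub _ _).trans (add_le_add (hM t ht) ?_)
    refine (Finset.abs_sum_le_sum_abs _ _).trans (le_trans ?_
      (hsum.sum_le_tsum F fun _ _ => abs_nonneg _))
    refine Finset.sum_le_sum fun j _ => ?_
    rw [abs_mul]
    refine mul_le_of_le_one_right (abs_nonneg _) ?_
    rw [abs_neg, abs_of_pos (by positivity), div_le_one hpos]
    linarith [Real.pi_gt_three]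
  have hmain := ofReal_abs_sub_le_of_jumps hC hl hr
    (add_nonneg hM0 (tsum_nonneg fun j : jumpSet f => abs_nonneg (jump f j))) hder hb hxy hx hy
  obtain ⟨hs1, hs2⟩ := tsum_ite_mem_eq hsum F
  have hnn : ∀ j : jumpSet f, 0 ≤ if j ∈ F then 0 else |jump f j| := fun j => by
    split_ifs <;> positivity
  have hjumps : ∑' c : ↥(C ∩ Ioo x y), ENNReal.ofReal
      |(Function.rightLim f c - ∑ j ∈ F, jump f j * sawtooth (c - j)) -
        (Function.leftLim f c - ∑ j ∈ F, jump f j * sawtoothLeft (c - j))| ≤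
      ENNReal.ofReal (∑' j : jumpSet f, |jump f j| - ∑ j ∈ F, |jump f j|) := by
    rw [← hs2, ENNReal.ofReal_tsum_of_nonneg hnn hs1]
    calc _ ≤ ∑' c : ↥(C ∩ Ioo x y), ∑' j : jumpSet f,
          (if ∃ k : ℤ, (c : ℝ) - j = k * (2 * Real.pi) then
            ENNReal.ofReal (if j ∈ F then 0 else |jump f j|) else 0) := by
          refine ENNReal.tsum_le_tsum fun c => ?_
          refine le_trans (le_of_eq ?_) (ofReal_abs_jump_remainder_le hf hbv h0 F c)
          congr 2
          simp only [jump, mul_sub, Finset.sum_sub_distrib]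
          ring
      _ = ∑' j : jumpSet f, ∑' c : ↥(C ∩ Ioo x y),
          (if ∃ k : ℤ, (c : ℝ) - j = k * (2 * Real.pi) then
            ENNReal.ofReal (if j ∈ F then 0 else |jump f j|) else 0) := ENNReal.tsum_comm
      _ ≤ _ := by
          refine ENNReal.tsum_le_tsum fun j => tsum_ite_subsingleton_le _ ?_ _
          rintro a b ⟨k, hk⟩ ⟨m, hm⟩
          refine Subtype.ext (eq_of_sub_eq_int_mul (k := k - m) ?_ ?_)
          · have ha := a.2.2
            have hb := b.2.2
            rw [abs_sub_lt_iff]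
            exact ⟨by linarith [ha.2, hb.1], by linarith [hb.2, ha.1]⟩
          · push_cast; linarith
  have hfin := hmain.trans (add_le_add le_rfl hjumps)
  have hM' : 0 ≤ M + ∑' j : jumpSet f, |jump f j| :=
    add_nonneg hM0 (tsum_nonneg fun _ => abs_nonneg _)
  have he : 0 ≤ ∑' j : jumpSet f, |jump f j| - ∑ j ∈ F, |jump f j| :=
    sub_nonneg.2 (hsum.sum_le_tsum F fun _ _ => abs_nonneg _)
  rw [← ENNReal.ofReal_add (mul_nonneg hM' (sub_nonneg.2 hxy)) he] at hfin
  exact (ENNReal.ofReal_le_ofReal_iff (add_nonneg (mul_nonneg hM' (sub_nonneg.2 hxy)) he)).1 hfin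

end Remainder

/-! ### Fourier coefficients: linearity, translation, sawtooth -/

section Coefficients

theorem periodic_exp (ν : ℤ) :
    Function.Periodic (fun x : ℝ => Complex.exp (-(Complex.I * ν * x))) (2 * Real.pi) := fun x => by
  simp only
  rw [Complex.exp_eq_exp_iff_exists_int]
  exact ⟨-ν, by push_cast; ring⟩

theorem intervalIntegrable_mul_exp {g : ℝ → ℝ} {a b : ℝ} (hg : IntervalIntegrable g volume a b)
    (ν : ℤ) : IntervalIntegrable (fun x => (g x : ℂ) * Complex.exp (-(Complex.I * ν * x)))
      volume a b :=
  IntervalIntegrable.mul_continuousOn (f := fun x => (g x : ℂ)) ⟨hg.1.ofReal, hg.2.ofReal⟩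
    (by fun_prop)

theorem coeff_sub {g h : ℝ → ℝ} (hg : IntervalIntegrable g volume 0 (2 * Real.pi))
    (hh : IntervalIntegrable h volume 0 (2 * Real.pi)) (ν : ℤ) :
    coeff (fun x => g x - h x) ν = coeff g ν - coeff h ν := by
  simp only [coeff_eq_integral]
  rw [← mul_sub, ← intervalIntegral.integral_sub (intervalIntegrable_mul_exp hg ν)
    (intervalIntegrable_mul_exp hh ν)]
  simp only [Complex.ofReal_sub, sub_mul]

theorem coeff_sum {ι : Type*} (F : Finset ι) (c : ι → ℝ) {g : ι → ℝ → ℝ}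
    (hg : ∀ i ∈ F, IntervalIntegrable (g i) volume 0 (2 * Real.pi)) (ν : ℤ) :
    coeff (fun x => ∑ i ∈ F, c i * g i x) ν = ∑ i ∈ F, (c i : ℂ) * coeff (g i) ν := by
  simp only [coeff_eq_integral]
  have e : ∀ x : ℝ, ((∑ i ∈ F, c i * g i x : ℝ) : ℂ) * Complex.exp (-(Complex.I * ν * x)) =
      ∑ i ∈ F, (c i : ℂ) * ((g i x : ℂ) * Complex.exp (-(Complex.I * ν * x))) := fun x => by
    push_cast
    rw [Finset.sum_mul]
    exact Finset.sum_congr rfl fun _ _ => by ring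
  simp_rw [e]
  rw [intervalIntegral.integral_finsetSum fun i hi =>
    (intervalIntegrable_mul_exp (hg i hi) ν).const_mul _, Finset.mul_sum]
  refine Finset.sum_congr rfl fun i _ => ?_
  rw [intervalIntegral.integral_const_mul]
  ring

theorem coeff_comp_add {g : ℝ → ℝ} (hg : Function.Periodic g (2 * Real.pi)) (s : ℝ) (ν : ℤ) :
    coeff (fun x => g (x + s)) ν = Complex.exp (Complex.I * ν * s) * coeff g ν := by
  simp only [coeff_eq_integral]
  have hper : Function.Periodic
      (fun x : ℝ => (g x : ℂ) * Complex.exp (-(Complex.I * ν * x))) (2 * Real.pi) := fun x => by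
    have := periodic_exp ν x
    simp only at this ⊢
    rw [this, hg x]
  have e : ∀ x : ℝ, (g (x + s) : ℂ) * Complex.exp (-(Complex.I * ν * x)) =
      Complex.exp (Complex.I * ν * s) *
        ((g (x + s) : ℂ) * Complex.exp (-(Complex.I * ν * ((x + s : ℝ) : ℂ)))) := fun x => by
    rw [mul_left_comm, ← Complex.exp_add]
    congr 2
    push_cast; ring
  simp_rw [e]
  rw [intervalIntegral.integral_const_mul, intervalIntegral.integral_comp_add_right
    (fun x : ℝ => (g x : ℂ) * Complex.exp (-(Complex.I * ν * (x : ℂ)))) s, zero_add, add_comm _ s,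
    hper.intervalIntegral_add_eq s 0, zero_add]
  ring

theorem intervalIntegrable_sawtooth (c a b : ℝ) :
    IntervalIntegrable (fun x => sawtooth (x - c)) volume a b := by
  refine (intervalIntegrable_const (c := (1 : ℝ))).mono_fun
    (measurable_sawtooth.comp (measurable_id.sub_const c)).aestronglyMeasurable ?_
  refine Eventually.of_forall fun x => ?_
  simpa using abs_sawtooth_le (x - c)

theorem integral_mul_exp {c : ℂ} (hc : c ≠ 0) (b : ℝ) :
    ∫ x in (0 : ℝ)..b, (x : ℂ) * Complex.exp (c * x) =
      Complex.exp (c * b) * (b / c - 1 / c ^ 2) + 1 / c ^ 2 := by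
  have h : ∀ x ∈ uIcc (0 : ℝ) b, HasDerivAt
      (fun x : ℝ => Complex.exp (c * x) * (x / c - 1 / c ^ 2)) ((x : ℂ) * Complex.exp (c * x)) x := by
    intro x _
    have h1 : HasDerivAt (fun x : ℝ => (x : ℂ)) 1 x := Complex.ofRealCLM.hasDerivAt
    have h2 := ((h1.const_mul c).cexp).mul ((h1.div_const c).sub_const (1 / c ^ 2))
    refine h2.congr_deriv ?_
    field_simp
    ring
  rw [intervalIntegral.integral_eq_sub_of_hasDerivAt h
    (Continuous.intervalIntegrable (by fun_prop) _ _)]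
  simp

theorem coeff_sawtooth {ν : ℤ} (hν : ν ≠ 0) :
    coeff sawtooth ν = 1 / (2 * Real.pi * Complex.I * ν) := by
  have hpi : (Real.pi : ℂ) ≠ 0 := by exact_mod_cast Real.pi_ne_zero
  have hν' : (ν : ℂ) ≠ 0 := by exact_mod_cast hν
  have hI := Complex.I_ne_zero
  rw [coeff_eq_integral]
  have e : ∫ x in (0 : ℝ)..(2 * Real.pi), (sawtooth x : ℂ) * Complex.exp (-(Complex.I * ν * x)) =
      ∫ x in (0 : ℝ)..(2 * Real.pi), (-(1 / (2 * Real.pi)) : ℂ) *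
        ((x : ℂ) * Complex.exp ((-(Complex.I * ν)) * x)) := by
    rw [intervalIntegral.integral_of_le Real.two_pi_pos.le,
      intervalIntegral.integral_of_le Real.two_pi_pos.le,
      integral_Ioc_eq_integral_Ioo, integral_Ioc_eq_integral_Ioo]
    refine setIntegral_congr_fun measurableSet_Ioo fun x hx => ?_
    rw [sawtooth_eq ⟨hx.1.le, hx.2⟩, neg_mul (Complex.I * (ν : ℂ))]
    push_cast
    ring
  have hexp : Complex.exp (-(Complex.I * ν) * ((2 * Real.pi : ℝ) : ℂ)) = 1 := by
    rw [Complex.exp_eq_one_iff]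
    exact ⟨-ν, by push_cast; ring⟩
  rw [e, intervalIntegral.integral_const_mul, integral_mul_exp (neg_ne_zero.2 (mul_ne_zero hI hν')),
    hexp]
  push_cast
  field_simp
  ring_nf

theorem coeff_sawtooth_sub {ν : ℤ} (hν : ν ≠ 0) (c : ℝ) :
    coeff (fun x => sawtooth (x - c)) ν =
      Complex.exp (-(Complex.I * ν * c)) / (2 * Real.pi * Complex.I * ν) := by
  have := coeff_comp_add sawtooth_periodic (-c) ν
  simp only [← sub_eq_add_neg] at this
  rw [this, coeff_sawtooth hν]
  push_cast
  rw [mul_neg]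
  ring

theorem intervalIntegrable_of_boundedVariationOn {f : ℝ → ℝ} {a b : ℝ} (hab : a ≤ b)
    (h : BoundedVariationOn f (Icc a b)) : IntervalIntegrable f volume a b := by
  obtain ⟨p, q, hp, hq, rfl⟩ := h.locallyBoundedVariationOn.exists_monotoneOn_sub_monotoneOn
  rw [← uIcc_of_le hab] at hp hq
  exact hp.intervalIntegrable.sub hq.intervalIntegrable

theorem coeff_neg (f : ℝ → ℝ) (ν : ℤ) : coeff f (-ν) = starRingEnd ℂ (coeff f ν) := by
  simp only [coeff_eq_integral]
  rw [map_mul, intervalIntegral.integral_of_le Real.two_pi_pos.le,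
    intervalIntegral.integral_of_le Real.two_pi_pos.le, ← integral_conj]
  congr 1
  · simp [map_ofNat]
  · refine integral_congr_ae (Eventually.of_forall fun x => ?_)
    simp only [map_mul, Complex.conj_ofReal, ← Complex.exp_conj, map_neg, Complex.conj_I, map_intCast]
    push_cast
    congr 2
    ring

end Coefficients

/-! ### Square summability of the coefficients of the smooth part -/

section Remainder

variable {f : ℝ → ℝ}

theorem jumpRemainder_periodic (hf : Function.Periodic f (2 * Real.pi)) (F : Finset (jumpSet f)) :
    Function.Periodic (jumpRemainder f F) (2 * Real.pi) := fun x => by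
  simp only [jumpRemainder, hf x, add_sub_right_comm, sawtooth_periodic _]

theorem intervalIntegrable_jumpRemainder (hf : Function.Periodic f (2 * Real.pi))
    (hbv : BoundedVariationOn f (Icc 0 (2 * Real.pi))) (F : Finset (jumpSet f)) (a b : ℝ) :
    IntervalIntegrable (jumpRemainder f F) volume a b := by
  have h1 : IntervalIntegrable f volume a b := hf.intervalIntegrable₀ Real.two_pi_pos.ne'
    (intervalIntegrable_of_boundedVariationOn Real.two_pi_pos.le hbv) a b
  have h2 := IntervalIntegrable.sum (f := fun (j : jumpSet f) (x : ℝ) =>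
    jump f j * sawtooth (x - j)) F fun j _ => (intervalIntegrable_sawtooth j a b).const_mul (jump f j)
  have h3 := h1.sub h2
  convert h3 using 1
  ext x
  simp [jumpRemainder]

theorem coeff_jumpRemainder
    (hbv : BoundedVariationOn f (Icc 0 (2 * Real.pi))) (F : Finset (jumpSet f)) {ν : ℤ}
    (hν : ν ≠ 0) :
    coeff (jumpRemainder f F) ν = coeff f ν - (∑ j ∈ F, (jump f j : ℂ) *
      Complex.exp (-(Complex.I * ν * (j : ℝ)))) / (2 * Real.pi * Complex.I * ν) := by
  have h1 : IntervalIntegrable f volume 0 (2 * Real.pi) :=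
    intervalIntegrable_of_boundedVariationOn Real.two_pi_pos.le hbv
  have h2 := IntervalIntegrable.sum (f := fun (j : jumpSet f) (x : ℝ) =>
    jump f j * sawtooth (x - j)) F fun j _ =>
      (intervalIntegrable_sawtooth j 0 (2 * Real.pi)).const_mul (jump f j)
  have h3 : IntervalIntegrable (fun x => ∑ j ∈ F, jump f j * sawtooth (x - j)) volume 0
      (2 * Real.pi) := by
    have e : (∑ j ∈ F, fun x : ℝ => jump f j * sawtooth (x - j)) =
        fun x => ∑ j ∈ F, jump f j * sawtooth (x - j) := by ext x; simp
    rwa [e] at h2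
  have e := coeff_sub h1 h3 ν
  rw [coeff_sum F (fun j : jumpSet f => jump f j) (g := fun (j : jumpSet f) x => sawtooth (x - j))
    (fun j _ => intervalIntegrable_sawtooth _ _ _)] at e
  refine e.trans ?_
  rw [Finset.sum_div]
  congr 1
  refine Finset.sum_congr rfl fun j _ => ?_
  rw [coeff_sawtooth_sub hν, mul_div_assoc]

/-- Parseval's identity for the difference between the remainder translated by `t` and itself:
translation multiplies the coefficients by `e^{iνt}`, and the difference is at most `B` almost
everywhere. -/
theorem sum_norm_sq_exp_sub_one_mul_coeff_le (hf : Function.Periodic f (2 * Real.pi))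
    (hbv : BoundedVariationOn f (Icc 0 (2 * Real.pi))) {C : Set ℝ} (hC : C.Countable)
    {F : Finset (jumpSet f)} {t B : ℝ}
    (hB : ∀ x ∉ C, x + t ∉ C → |jumpRemainder f F (x + t) - jumpRemainder f F x| ≤ B) (N : ℕ) :
    ∑ ν ∈ Finset.Icc 1 N,
      ‖(Complex.exp (Complex.I * (ν : ℤ) * t) - 1) * coeff (jumpRemainder f F) ν‖ ^ 2 ≤ B ^ 2 := by
  set u : ℝ → ℝ := fun x => jumpRemainder f F (x + t) - jumpRemainder f F x with hu
  have hpos := Real.two_pi_pos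
  have hint := intervalIntegrable_jumpRemainder hf hbv F
  have hint2 : IntervalIntegrable (fun x => jumpRemainder f F (x + t)) volume 0 (2 * Real.pi) := by
    simpa using (hint (0 + t) (2 * Real.pi + t)).comp_add_right t
  have hae : ∀ᵐ x : ℝ, ‖(u x : ℂ)‖ ≤ B := by
    have h1 : ∀ᵐ x : ℝ, x ∉ C := hC.ae_notMem _
    have h2 : ∀ᵐ x : ℝ, x ∉ (fun x => x + t) ⁻¹' C :=
      (hC.preimage (add_left_injective t)).ae_notMem _
    filter_upwards [h1, h2] with x hx1 hx2
    rw [Complex.norm_real]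
    exact hB x hx1 hx2
  have hcoeff : ∀ ν : ℤ, coeff u ν =
      (Complex.exp (Complex.I * ν * t) - 1) * coeff (jumpRemainder f F) ν := fun ν => by
    rw [hu, coeff_sub hint2 (hint _ _), coeff_comp_add (jumpRemainder_periodic hf F)]
    ring
  have hmeas : AEStronglyMeasurable (fun x => (u x : ℂ)) (volume.restrict (Ioc 0 (2 * Real.pi))) :=
    Complex.continuous_ofReal.comp_aestronglyMeasurable (hint2.sub (hint _ _)).1.aestronglyMeasurable
  have hL2 : MemLp (fun x => (u x : ℂ)) 2 (volume.restrict (Ioc 0 (2 * Real.pi))) :=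
    MemLp.of_bound hmeas B (ae_restrict_of_ae hae)
  have hsum := hasSum_sq_fourierCoeffOn hpos hL2
  have hle := sum_le_hasSum ((Finset.Icc 1 N).map Nat.castEmbedding) (fun i _ => by positivity) hsum
  rw [Finset.sum_map] at hle
  calc _ = ∑ ν ∈ Finset.Icc 1 N, ‖coeff u ν‖ ^ 2 :=
        Finset.sum_congr rfl fun ν _ => by rw [hcoeff]
    _ ≤ _ := hle
    _ ≤ (2 * Real.pi - 0)⁻¹ • (B ^ 2 * (2 * Real.pi)) := by
        rw [smul_eq_mul, smul_eq_mul]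
        refine mul_le_mul_of_nonneg_left ?_ (by rw [sub_zero]; positivity)
        have h3 : ‖∫ x in (0 : ℝ)..(2 * Real.pi), ‖(u x : ℂ)‖ ^ 2‖ ≤ B ^ 2 * |2 * Real.pi - 0| := by
          refine intervalIntegral.norm_integral_le_of_norm_le_const_ae ?_
          filter_upwards [hae] with x hx _
          rw [norm_pow, norm_norm]
          gcongr
        rw [sub_zero, abs_of_pos hpos] at h3
        exact (le_abs_self _).trans h3
    _ = B ^ 2 := by
        rw [sub_zero, smul_eq_mul]
        field_simp

/-- What is left of the Fourier coefficient when the contribution of the jumps is taken away. -/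
noncomputable def smoothCoeff (f : ℝ → ℝ) (ν : ℤ) : ℂ :=
  coeff f ν - (∑' j : jumpSet f, (jump f j : ℂ) *
      Complex.exp (-(Complex.I * ν * (j : ℝ)))) / (2 * Real.pi * Complex.I * ν)

theorem summable_jump_mul_exp (hsum : Summable fun j : jumpSet f => |jump f j|) (ν : ℤ) :
    Summable fun j : jumpSet f => (jump f j : ℂ) * Complex.exp (-(Complex.I * ν * (j : ℝ))) := by
  refine Summable.of_norm_bounded hsum fun j => ?_
  have : -(Complex.I * ν * ((j : ℝ) : ℂ)) = ((-(ν * (j : ℝ)) : ℝ) : ℂ) * Complex.I := by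
    push_cast; ring
  rw [norm_mul, this, Complex.norm_exp_ofReal_mul_I]
  simp

/-- The remainders behave like a Lipschitz function up to a vanishing error. In the Parseval bound
for increments, letting `F` exhaust the jumps removes the error; dividing by `t²` and letting `t →
0+` turns `e^{iνt} - 1` into `iν`. The limit function itself is never needed. -/
theorem exists_sum_sq_smoothCoeff_le (hf : Function.Periodic f (2 * Real.pi))
    (hbv : BoundedVariationOn f (Icc 0 (2 * Real.pi))) (hd : HasBVDeriv f) (h0 : jump f 0 = 0) :
    ∃ D, ∀ N : ℕ, ∑ ν ∈ Finset.Icc 1 N, (ν : ℝ) ^ 2 * ‖smoothCoeff f ν‖ ^ 2 ≤ D := by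
  obtain ⟨C, hC, M, hM, hlip⟩ := exists_remainder_lipschitz hf hbv hd h0
  have hsum := summable_jump hf hbv
  have hstep : ∀ t, 0 < t → t < 2 * Real.pi → ∀ N : ℕ, ∑ ν ∈ Finset.Icc 1 N,
      ‖(Complex.exp (Complex.I * (ν : ℤ) * t) - 1) * smoothCoeff f ν‖ ^ 2 ≤ (M * t) ^ 2 := by
    intro t ht ht2 N
    have hB := fun F : Finset (jumpSet f) => sum_norm_sq_exp_sub_one_mul_coeff_le hf hbv hC (F := F)
      (t := t) (B := M * t + (∑' j : jumpSet f, |jump f j| - ∑ j ∈ F, |jump f j|))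
      (fun x hx hxt => by
        have := hlip F x hx (x + t) hxt (by linarith) (by linarith)
        rwa [add_sub_cancel_left] at this) N
    have hR : Tendsto (fun F : Finset (jumpSet f) =>
        (M * t + (∑' j : jumpSet f, |jump f j| - ∑ j ∈ F, |jump f j|)) ^ 2) atTop
        (𝓝 ((M * t) ^ 2)) := by
      have h1 : Tendsto (fun F : Finset (jumpSet f) =>
          ∑' j : jumpSet f, |jump f j| - ∑ j ∈ F, |jump f j|) atTop (𝓝 0) := by
        simpa using hsum.hasSum.const_sub (∑' j : jumpSet f, |jump f j|)
      simpa using (h1.const_add (M * t)).pow 2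
    refine le_of_tendsto_of_tendsto' (tendsto_finsetSum _ fun ν hν => ?_) hR hB
    refine ((Tendsto.const_mul _ ?_).norm).pow 2
    have hν0 : (ν : ℤ) ≠ 0 := by
      have := (Finset.mem_Icc.1 hν).1
      omega
    simp_rw [coeff_jumpRemainder hbv _ hν0]
    exact (Tendsto.div_const (summable_jump_mul_exp hsum ν).hasSum _).const_sub _
  refine ⟨M ^ 2, fun N => ?_⟩
  have hlim : Tendsto (fun t : ℝ => ∑ ν ∈ Finset.Icc 1 N,
      ‖t⁻¹ • ((Complex.exp (Complex.I * (ν : ℤ) * t) - 1) * smoothCoeff f ν)‖ ^ 2) (𝓝[>] 0)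
      (𝓝 (∑ ν ∈ Finset.Icc 1 N, (ν : ℝ) ^ 2 * ‖smoothCoeff f ν‖ ^ 2)) := by
    refine tendsto_finsetSum _ fun ν _ => ?_
    have hder : HasDerivAt (fun t : ℝ => Complex.exp (Complex.I * (ν : ℤ) * t))
        (Complex.I * (ν : ℤ)) 0 := by
      have h1 : HasDerivAt (fun x : ℝ => (x : ℂ)) 1 0 := Complex.ofRealCLM.hasDerivAt
      have := (h1.const_mul (Complex.I * (ν : ℤ))).cexp
      simpa using this
    have h2 := hder.tendsto_slope_zero_right
    have h3 := ((h2.mul_const (smoothCoeff f ν)).norm).pow 2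
    have e : ‖Complex.I * (ν : ℤ) * smoothCoeff f ν‖ ^ 2 = (ν : ℝ) ^ 2 * ‖smoothCoeff f ν‖ ^ 2 := by
      rw [norm_mul, norm_mul, Complex.norm_I, one_mul, mul_pow]
      simp
    rw [e] at h3
    refine h3.congr fun t => ?_
    simp [mul_assoc]
  refine le_of_tendsto hlim ?_
  filter_upwards [Ioo_mem_nhdsGT Real.two_pi_pos] with t ht
  have := hstep t ht.1 ht.2 N
  simp_rw [norm_smul, mul_pow]
  rw [← Finset.mul_sum, norm_inv, inv_pow, Real.norm_of_nonneg ht.1.le,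
    inv_mul_le_iff₀ (by have := ht.1; positivity)]
  simp_rw [norm_mul, mul_pow] at this ⊢
  linarith

/-- The product of `ν|smoothCoeff f ν|` and `1/ν` is at most the sum of their squares, and both
squares are summable. -/
theorem exists_sum_norm_smoothCoeff_le (hf : Function.Periodic f (2 * Real.pi))
    (hbv : BoundedVariationOn f (Icc 0 (2 * Real.pi))) (hd : HasBVDeriv f) (h0 : jump f 0 = 0) :
    ∃ D, ∀ N : ℕ, ∑ ν ∈ Finset.Icc 1 N, ‖smoothCoeff f ν‖ ≤ D := by
  obtain ⟨D, hD⟩ := exists_sum_sq_smoothCoeff_le hf hbv hd h0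
  have hs : Summable fun n : ℕ => ((n : ℝ) ^ 2)⁻¹ := Real.summable_nat_pow_inv.2 one_lt_two
  refine ⟨D + ∑' n : ℕ, ((n : ℝ) ^ 2)⁻¹, fun N => ?_⟩
  refine le_trans ?_ (add_le_add (hD N)
    (hs.sum_le_tsum (Finset.Icc 1 N) fun _ _ => by positivity))
  rw [← Finset.sum_add_distrib]
  refine Finset.sum_le_sum fun ν hν => ?_
  have hν0 : (0 : ℝ) < ν := by exact_mod_cast (Finset.mem_Icc.1 hν).1
  have h1 : ‖smoothCoeff f ν‖ = (ν * ‖smoothCoeff f ν‖) * (ν : ℝ)⁻¹ := by field_simp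
  rw [← mul_pow, ← inv_pow]
  rw [h1]
  have h2 : (ν : ℝ) * (ν * ‖smoothCoeff f ν‖ * (ν : ℝ)⁻¹) = ν * ‖smoothCoeff f ν‖ := by field_simp
  rw [h2]
  nlinarith [sq_nonneg ((ν : ℝ) * ‖smoothCoeff f ν‖ - (ν : ℝ)⁻¹),
    sq_nonneg ((ν : ℝ) * ‖smoothCoeff f ν‖), sq_nonneg ((ν : ℝ)⁻¹)]

end Remainder

/-! ### Size and variation of the smooth part -/

section SmoothPart

/-- The part of the conjugate partial sums that does not come from the jumps. -/
noncomputable def smoothConj (f : ℝ → ℝ) (k : ℕ) (x : ℝ) : ℝ :=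
  ∑ ν ∈ Finset.Icc 1 k, 2 * (smoothCoeff f ν * Complex.exp (Complex.I * ν * x)).im

theorem norm_exp_I_mul (a b : ℝ) : ‖Complex.exp (Complex.I * a * b)‖ = 1 := by
  have : Complex.I * a * b = ((a * b : ℝ) : ℂ) * Complex.I := by push_cast; ring
  rw [this, Complex.norm_exp_ofReal_mul_I]

theorem abs_smoothConj_le (f : ℝ → ℝ) {D : ℝ}
    (hD : ∀ N : ℕ, ∑ ν ∈ Finset.Icc 1 N, ‖smoothCoeff f ν‖ ≤ D) (k : ℕ) (x : ℝ) :
    |smoothConj f k x| ≤ 2 * D := by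
  refine (Finset.abs_sum_le_sum_abs _ _).trans
    (le_trans ?_ (mul_le_mul_of_nonneg_left (hD k) two_pos.le))
  rw [Finset.mul_sum]
  refine Finset.sum_le_sum fun ν _ => ?_
  rw [abs_mul, abs_two]
  refine mul_le_mul_of_nonneg_left ((Complex.abs_im_le_norm _).trans ?_) two_pos.le
  have := norm_exp_I_mul ν x
  push_cast at this
  rw [norm_mul, this, mul_one]

theorem integral_exp_int_mul {m : ℤ} (hm : m ≠ 0) :
    ∫ x in (0 : ℝ)..(2 * Real.pi), Complex.exp (Complex.I * m * x) = 0 := by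
  have hc : Complex.I * m ≠ 0 := mul_ne_zero Complex.I_ne_zero (by exact_mod_cast hm)
  rw [integral_exp_mul_complex hc]
  have : Complex.exp (Complex.I * m * ((2 * Real.pi : ℝ) : ℂ)) = 1 := by
    rw [Complex.exp_eq_one_iff]
    exact ⟨m, by push_cast; ring⟩
  rw [this]
  simp

theorem integral_norm_sq_trigPolynomial (q : ℕ → ℂ) (F : Finset ℕ) :
    ∫ x in (0 : ℝ)..(2 * Real.pi), ‖∑ ν ∈ F, q ν * Complex.exp (Complex.I * ν * x)‖ ^ 2 =
      2 * Real.pi * ∑ ν ∈ F, ‖q ν‖ ^ 2 := by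
  have e : ∀ x : ℝ, ((‖∑ ν ∈ F, q ν * Complex.exp (Complex.I * ν * x)‖ ^ 2 : ℝ) : ℂ) =
      ∑ ν ∈ F, ∑ μ ∈ F, (q ν * starRingEnd ℂ (q μ)) *
        Complex.exp (Complex.I * ((ν - μ : ℤ) : ℂ) * x) := fun x => by
    push_cast
    rw [← Complex.mul_conj', map_sum, Finset.sum_mul_sum]
    refine Finset.sum_congr rfl fun ν _ => Finset.sum_congr rfl fun μ _ => ?_
    rw [map_mul, ← Complex.exp_conj, mul_mul_mul_comm, ← Complex.exp_add]
    simp only [map_mul, Complex.conj_I, Complex.conj_ofReal, map_natCast]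
    congr 2
    ring
  have h : (((∫ x in (0 : ℝ)..(2 * Real.pi),
      ‖∑ ν ∈ F, q ν * Complex.exp (Complex.I * ν * x)‖ ^ 2 : ℝ)) : ℂ) =
      ((2 * Real.pi * ∑ ν ∈ F, ‖q ν‖ ^ 2 : ℝ) : ℂ) := by
    rw [← intervalIntegral.integral_ofReal]
    simp_rw [e]
    rw [intervalIntegral.integral_finsetSum fun ν _ =>
      Continuous.intervalIntegrable (by fun_prop) _ _]
    push_cast
    rw [Finset.mul_sum]
    refine Finset.sum_congr rfl fun ν hν => ?_
    rw [intervalIntegral.integral_finsetSum fun μ _ =>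
      Continuous.intervalIntegrable (by fun_prop) _ _]
    rw [Finset.sum_eq_single_of_mem ν hν fun μ _ hμ => ?_]
    · simp [Complex.mul_conj']
    · have := integral_exp_int_mul (m := (ν : ℤ) - μ) (by omega)
      rw [intervalIntegral.integral_const_mul]
      push_cast at this ⊢
      rw [this, mul_zero]
  exact_mod_cast h

theorem hasDerivAt_smoothConj (f : ℝ → ℝ) (k : ℕ) (x : ℝ) :
    HasDerivAt (smoothConj f k)
      (∑ ν ∈ Finset.Icc 1 k, 2 * ν * smoothCoeff f ν * Complex.exp (Complex.I * ν * x)).re x := by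
  have h : ∀ ν ∈ Finset.Icc 1 k, HasDerivAt
      (fun x : ℝ => 2 * (smoothCoeff f ν * Complex.exp (Complex.I * (ν : ℂ) * x)).im)
      (2 * ν * smoothCoeff f ν * Complex.exp (Complex.I * ν * x)).re x := fun ν _ => by
    have h1 : HasDerivAt (fun x : ℝ => (x : ℂ)) 1 x := Complex.ofRealCLM.hasDerivAt
    have h2 := ((h1.const_mul (Complex.I * (ν : ℂ))).cexp).const_mul (smoothCoeff f ν)
    have h3 : HasDerivAt (fun x : ℝ =>
        (smoothCoeff f ν * Complex.exp (Complex.I * (ν : ℂ) * x)).im) _ x :=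
      Complex.imCLM.hasFDerivAt.comp_hasDerivAt x h2
    refine (h3.const_mul 2).congr_deriv ?_
    have e : smoothCoeff f ν * (Complex.exp (Complex.I * ν * x) * (Complex.I * ν * 1)) =
        Complex.I * ((ν : ℝ) * (smoothCoeff f ν * Complex.exp (Complex.I * ν * x))) := by
      push_cast; ring
    have e2 : 2 * ν * smoothCoeff f ν * Complex.exp (Complex.I * ν * x) =
        ((2 * ν : ℝ) : ℂ) * (smoothCoeff f ν * Complex.exp (Complex.I * ν * x)) := by
      push_cast; ring
    rw [Complex.imCLM_apply, e, Complex.I_mul_im, Complex.re_ofReal_mul, e2, Complex.re_ofReal_mul]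
    ring
  have := HasDerivAt.fun_sum h
  rw [← Complex.re_sum] at this
  exact this

/-- Increments of `g` are dominated by those of the monotone primitive of `q`, whose variation is
its total increase. -/
theorem eVariationOn_le_integral_of_hasDerivAt {g g' : ℝ → ℝ} {q : ℝ → ℝ} {a b : ℝ} (hab : a ≤ b)
    (hg : ∀ x, HasDerivAt g (g' x) x) (hg' : Continuous g') (hq : Continuous q)
    (hle : ∀ x, |g' x| ≤ q x) :
    eVariationOn g (Icc a b) ≤ ENNReal.ofReal (∫ x in a..b, q x) := by
  have hq0 : ∀ x, 0 ≤ q x := fun x => (abs_nonneg _).trans (hle x)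
  set P : ℝ → ℝ := fun x => ∫ y in a..x, q y with hP
  have hPsub : ∀ x y, P y - P x = ∫ t in x..y, q t := fun x y =>
    intervalIntegral.integral_interval_sub_left (hq.intervalIntegrable _ _)
      (hq.intervalIntegrable _ _)
  have hPm : Monotone P := fun x y hxy => by
    rw [← sub_nonneg, hPsub]
    exact intervalIntegral.integral_nonneg hxy fun t _ => hq0 t
  have key : ∀ x y, x ≤ y → edist (g x) (g y) ≤ edist (P x) (P y) := fun x y hxy => by
    rw [edist_comm, edist_comm (P x), edist_eq_enorm_sub, edist_eq_enorm_sub, hPsub,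
      ← intervalIntegral.integral_eq_sub_of_hasDerivAt (fun t _ => hg t)
        (hg'.intervalIntegrable _ _), Real.enorm_eq_ofReal_abs, Real.enorm_eq_ofReal_abs,
        abs_of_nonneg (intervalIntegral.integral_nonneg hxy fun t _ => hq0 t)]
    refine ENNReal.ofReal_le_ofReal ?_
    refine (intervalIntegral.abs_integral_le_integral_abs hxy).trans ?_
    exact intervalIntegral.integral_mono_on hxy (hg'.abs.intervalIntegrable _ _)
      (hq.intervalIntegrable _ _) fun t _ => hle t
  have h1 : eVariationOn g (Icc a b) ≤ eVariationOn P (Icc a b) := by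
    have := eVariationOn_le_sum (h := g) (g := fun _ : Unit => P) (w := 1) (s := Icc a b)
      Finset.univ fun x _ y _ => by
        rcases le_total x y with hxy | hxy
        · simpa using key x y hxy
        · simpa [edist_comm] using key y x hxy
    simpa using this
  refine h1.trans ?_
  have h2 := (hPm.monotoneOn (Icc a b)).eVariationOn_eq (left_mem_Icc.2 hab) (right_mem_Icc.2 hab)
  rw [inter_self] at h2
  rw [h2, hPsub]

theorem eVariationOn_smoothConj_le (f : ℝ → ℝ) {D : ℝ}
    (hD : ∀ N : ℕ, ∑ ν ∈ Finset.Icc 1 N, (ν : ℝ) ^ 2 * ‖smoothCoeff f ν‖ ^ 2 ≤ D) (k : ℕ) :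
    eVariationOn (smoothConj f k) (Icc 0 (2 * Real.pi)) ≤
      ENNReal.ofReal (Real.pi + 4 * Real.pi * D) := by
  set Q : ℝ → ℂ := fun x =>
    ∑ ν ∈ Finset.Icc 1 k, 2 * ν * smoothCoeff f ν * Complex.exp (Complex.I * ν * x) with hQ
  have hQc : Continuous Q := by simp only [hQ]; fun_prop
  refine (eVariationOn_le_integral_of_hasDerivAt Real.two_pi_pos.le (hasDerivAt_smoothConj f k)
    -- The inequality `|Q| ≤ (1 + |Q|²)/2` replaces the integral of `|Q|` by a mean square, computed
    -- by orthogonality. Over a period the two terms give `π` and at most `4πD`.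
    (q := fun x => 1 / 2 + (1 / 2) * ‖Q x‖ ^ 2) (Complex.continuous_re.comp hQc) (by fun_prop)
    fun x => ?_).trans (ENNReal.ofReal_le_ofReal ?_)
  · refine (Complex.abs_re_le_norm _).trans ?_
    change ‖Q x‖ ≤ _
    nlinarith [sq_nonneg (‖Q x‖ - 1)]
  · rw [intervalIntegral.integral_add (Continuous.intervalIntegrable (by fun_prop) _ _)
      (Continuous.intervalIntegrable (by fun_prop) _ _), intervalIntegral.integral_const_mul,
      integral_norm_sq_trigPolynomial (fun ν => 2 * ν * smoothCoeff f ν), intervalIntegral.integral_const,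
      smul_eq_mul, sub_zero]
    have e : ∑ ν ∈ Finset.Icc 1 k, ‖2 * (ν : ℂ) * smoothCoeff f ν‖ ^ 2 =
        4 * ∑ ν ∈ Finset.Icc 1 k, (ν : ℝ) ^ 2 * ‖smoothCoeff f ν‖ ^ 2 := by
      rw [Finset.mul_sum]
      refine Finset.sum_congr rfl fun ν _ => ?_
      rw [norm_mul, norm_mul, Complex.norm_natCast, Complex.norm_ofNat]
      ring
    rw [e]
    nlinarith [hD k, Real.pi_pos]

end SmoothPart

/-! ### Splitting the conjugate sums into spikes and a smooth part -/

section ConjugateSums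

variable {f : ℝ → ℝ}

/-- Since `f` is real, the terms of index `ν` and `-ν` combine into a difference of conjugates; the
sum is therefore real. -/
theorem conjPartialSum_eq (f : ℝ → ℝ) (k : ℕ) (x : ℝ) :
    conjPartialSum f k x =
      ((∑ ν ∈ Finset.Icc 1 k, 2 * (coeff f ν * Complex.exp (Complex.I * ν * x)).im : ℝ) : ℂ) := by
  induction k with
  | zero => simp [conjPartialSum]
  | succ k ih =>
    rw [Finset.sum_Icc_succ_top (by omega), Complex.ofReal_add, ← ih, conjPartialSum,
      conjPartialSum, Nat.cast_succ, Finset.sum_Icc_succ_eq_add_endpoints, mul_add, add_comm]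
    congr 1
    have h1 : ((k : ℤ) + 1).sign = 1 := Int.sign_eq_one_of_pos (by positivity)
    rw [Int.sign_neg, h1, coeff_neg]
    have h2 : Complex.exp (Complex.I * ((-((k : ℤ) + 1) : ℤ) : ℂ) * x) =
        starRingEnd ℂ (Complex.exp (Complex.I * (((k : ℤ) + 1 : ℤ) : ℂ) * x)) := by
      rw [← Complex.exp_conj]
      simp only [map_mul, Complex.conj_I, Complex.conj_ofReal, map_intCast]
      push_cast
      congr 1
      ring
    rw [h2]
    have h3 : ∀ w : ℂ, w - starRingEnd ℂ w = 2 * w.im * Complex.I := fun w => by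
      rw [Complex.sub_conj]
      push_cast; ring
    have h4 := h3 (coeff f ((k : ℤ) + 1) * Complex.exp (Complex.I * (((k : ℤ) + 1 : ℤ) : ℂ) * x))
    rw [map_mul] at h4
    push_cast at h4 ⊢
    have h5 : Complex.I * Complex.I = -1 := Complex.I_mul_I
    linear_combination (-Complex.I) * h4 + (-2 *
      ((coeff f ((k : ℤ) + 1) * Complex.exp (Complex.I * ((k : ℂ) + 1) * x)).im : ℂ)) * h5

theorem two_mul_im_coeff_eq (hsum : Summable fun j : jumpSet f => |jump f j|) {ν : ℕ} (hν : ν ≠ 0)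
    (x : ℝ) :
    2 * (coeff f ν * Complex.exp (Complex.I * ν * x)).im =
      -(1 / Real.pi) * (∑' j : jumpSet f, jump f j * (Real.cos (ν * (x - j)) / ν)) +
        2 * (smoothCoeff f ν * Complex.exp (Complex.I * ν * x)).im := by
  set z : ℂ := ∑' j : jumpSet f, (jump f j : ℂ) * Complex.exp (-(Complex.I * (ν : ℤ) * (j : ℝ))) with hz
  have hν' : (ν : ℝ) ≠ 0 := by exact_mod_cast hν
  have hνc : (ν : ℂ) ≠ 0 := by exact_mod_cast hν
  have hpi : (Real.pi : ℂ) ≠ 0 := by exact_mod_cast Real.pi_ne_zero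
  have hI := Complex.I_ne_zero
  have h1 : coeff f ν = smoothCoeff f ν + ((-(1 / (2 * Real.pi * ν)) : ℝ) : ℂ) * (Complex.I * z) := by
    rw [smoothCoeff, ← hz]
    push_cast
    field_simp
    rw [Complex.I_sq]
    ring
  have hs := (summable_jump_mul_exp hsum ν).mul_right (Complex.exp (Complex.I * ν * x))
  have h2 : (z * Complex.exp (Complex.I * ν * x)).re =
      ∑' j : jumpSet f, jump f j * Real.cos (ν * (x - j)) := by
    rw [hz, ← tsum_mul_right, Complex.re_tsum hs]
    refine tsum_congr fun j => ?_
    rw [mul_assoc, ← Complex.exp_add, Complex.re_ofReal_mul]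
    have : -(Complex.I * ((ν : ℤ) : ℂ) * ((j : ℝ) : ℂ)) + Complex.I * (ν : ℂ) * (x : ℂ) =
        ((ν * (x - j) : ℝ) : ℂ) * Complex.I := by push_cast; ring
    rw [this, Complex.exp_ofReal_mul_I_re]
  have h3 : ∑' j : jumpSet f, jump f j * (Real.cos (ν * (x - j)) / ν) =
      (∑' j : jumpSet f, jump f j * Real.cos (ν * (x - j))) / ν := by
    rw [← tsum_div_const]
    exact tsum_congr fun j => by ring
  rw [h1, add_mul, Complex.add_im, mul_assoc ((-(1 / (2 * Real.pi * ν)) : ℝ) : ℂ) (Complex.I * z),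
    Complex.im_ofReal_mul, mul_assoc Complex.I z, Complex.I_mul_im, h2, h3]
  have := Real.pi_ne_zero
  field_simp
  ring

theorem summable_jump_mul_cosSum (hsum : Summable fun j : jumpSet f => |jump f j|) (k : ℕ) (x : ℝ) :
    Summable fun j : jumpSet f => jump f j * cosSum k (x - j) := by
  refine Summable.of_norm_bounded (hsum.mul_right (harmonicSum k)) fun j => ?_
  rw [Real.norm_eq_abs, abs_mul]
  exact mul_le_mul_of_nonneg_left (abs_cosSum_le k _) (abs_nonneg _)

theorem conjPartialSum_eq_cosSum (hsum : Summable fun j : jumpSet f => |jump f j|) (k : ℕ) (x : ℝ) :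
    conjPartialSum f k x = ((-(1 / Real.pi) * (∑' j : jumpSet f, jump f j * cosSum k (x - j)) +
      smoothConj f k x : ℝ) : ℂ) := by
  rw [conjPartialSum_eq]
  congr 1
  have h1 : ∀ ν ∈ Finset.Icc 1 k, 2 * (coeff f ν * Complex.exp (Complex.I * ν * x)).im = _ :=
    fun ν hν => two_mul_im_coeff_eq hsum (by have := (Finset.mem_Icc.1 hν).1; omega) x
  rw [Finset.sum_congr rfl h1, Finset.sum_add_distrib, ← Finset.mul_sum]
  congr 2
  rw [← Summable.tsum_finsetSum]
  · exact tsum_congr fun j => by rw [cosSum, Finset.mul_sum]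
  · intro ν hν
    refine Summable.of_norm_bounded hsum fun j => ?_
    have h2 : (1 : ℝ) ≤ ν := by exact_mod_cast (Finset.mem_Icc.1 hν).1
    rw [Real.norm_eq_abs, abs_mul, abs_div, Nat.abs_cast]
    refine mul_le_of_le_one_right (abs_nonneg _) ?_
    rw [div_le_one (by linarith)]
    exact (Real.abs_cos_le_one _).trans h2

/-- The normalizing factor `1 / (log(n) G(n))`. -/
noncomputable def weight (f : ℝ → ℝ) (n : ℕ) : ℝ := (Real.log n * coeffSum f n)⁻¹

/-- The weighted mean of the kernels `cosSum` that each jump contributes to `Yseq`. -/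
noncomputable def spike (f : ℝ → ℝ) (n : ℕ) (t : ℝ) : ℝ :=
  ∑ k ∈ Finset.Icc 1 n, (weight f n * ‖coeff f k‖) * cosSum k t

/-- The part of `Yseq` that does not come from the jumps. -/
noncomputable def spikeRemainder (f : ℝ → ℝ) (n : ℕ) (x : ℝ) : ℝ :=
  ∑ k ∈ Finset.Icc 1 n, (weight f n * ‖coeff f k‖) * smoothConj f k x

theorem summable_jump_mul_spike (hsum : Summable fun j : jumpSet f => |jump f j|) (n : ℕ) (x : ℝ) :
    Summable fun j : jumpSet f => jump f j * spike f n (x - j) := by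
  have := summable_sum (s := Finset.Icc 1 n)
    (f := fun (k : ℕ) (j : jumpSet f) => (weight f n * ‖coeff f k‖) * (jump f j * cosSum k (x - j)))
    fun k _ => (summable_jump_mul_cosSum hsum k x).mul_left _
  refine this.congr fun j => ?_
  rw [spike, Finset.mul_sum]
  exact Finset.sum_congr rfl fun _ _ => by ring

theorem Yseq_eq (hsum : Summable fun j : jumpSet f => |jump f j|) (n : ℕ) (x : ℝ) :
    Yseq f n x = (((∑' j : jumpSet f, 1 / Real.pi * jump f j * spike f n (x - j)) -
      spikeRemainder f n x : ℝ) : ℂ) := by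
  have h1 : ∑' j : jumpSet f, 1 / Real.pi * jump f j * spike f n (x - j) =
      1 / Real.pi * ∑ k ∈ Finset.Icc 1 n, (weight f n * ‖coeff f k‖) *
        ∑' j : jumpSet f, jump f j * cosSum k (x - j) := by
    simp_rw [mul_assoc (1 / Real.pi), tsum_mul_left, ← tsum_mul_left (a := weight f n * _)]
    rw [← Summable.tsum_finsetSum fun k _ => (summable_jump_mul_cosSum hsum k x).mul_left _]
    congr 1
    refine tsum_congr fun j => ?_
    rw [spike, Finset.mul_sum]
    exact Finset.sum_congr rfl fun _ _ => by ring
  rw [h1, Yseq]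
  simp_rw [conjPartialSum_eq_cosSum hsum]
  rw [show -(1 / ((Real.log n * coeffSum f n : ℝ) : ℂ)) = ((-weight f n : ℝ) : ℂ) by
    rw [weight]; push_cast; ring, spikeRemainder]
  norm_cast
  rw [Finset.mul_sum, Finset.mul_sum, ← Finset.sum_sub_distrib]
  exact Finset.sum_congr rfl fun k _ => by ring

theorem coeffSum_eq (f : ℝ → ℝ) (n : ℕ) :
    coeffSum f n = ‖coeff f 0‖ + ∑ k ∈ Finset.Icc 1 n, ‖coeff f k‖ := by
  rw [coeffSum, Finset.sum_range_succ', sum_Icc_one_eq_sum_range, add_comm]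
  simp

theorem weight_nonneg (f : ℝ → ℝ) (n : ℕ) : 0 ≤ weight f n :=
  inv_nonneg.2 (mul_nonneg (Real.log_natCast_nonneg n) (Finset.sum_nonneg fun _ _ => norm_nonneg _))

/-- This small total mass makes every contribution bounded uniformly in `k` negligible. An
inequality suffices: it absorbs the missing index `0` and the degenerate case where the normalizing
product is zero. -/
theorem sum_weight_le (f : ℝ → ℝ) (n : ℕ) :
    ∑ k ∈ Finset.Icc 1 n, weight f n * ‖coeff f k‖ ≤ (Real.log n)⁻¹ := by
  rw [← Finset.mul_sum]
  have h0 : 0 ≤ ∑ k ∈ Finset.Icc 1 n, ‖coeff f k‖ := Finset.sum_nonneg fun _ _ => norm_nonneg _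
  have h1 : ∑ k ∈ Finset.Icc 1 n, ‖coeff f k‖ ≤ coeffSum f n := by
    rw [coeffSum_eq]; linarith [norm_nonneg (coeff f 0)]
  have hl : 0 ≤ (Real.log n)⁻¹ := inv_nonneg.2 (Real.log_natCast_nonneg n)
  calc _ ≤ weight f n * coeffSum f n := mul_le_mul_of_nonneg_left h1 (weight_nonneg f n)
    _ = (Real.log n)⁻¹ * ((coeffSum f n)⁻¹ * coeffSum f n) := by rw [weight, mul_inv]; ring
    _ ≤ (Real.log n)⁻¹ * 1 := mul_le_mul_of_nonneg_left inv_mul_le_one hl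
    _ = _ := mul_one _

theorem weighted_harmonicSum_le (f : ℝ → ℝ) (n : ℕ) :
    ∑ k ∈ Finset.Icc 1 n, weight f n * ‖coeff f k‖ * harmonicSum k ≤
      (Real.log n)⁻¹ * harmonicSum n := by
  refine le_trans ?_ (mul_le_mul_of_nonneg_right (sum_weight_le f n) (harmonicSum_nonneg n))
  rw [Finset.sum_mul]
  refine Finset.sum_le_sum fun k hk => mul_le_mul_of_nonneg_left
    (harmonicSum_mono (Finset.mem_Icc.1 hk).2) (mul_nonneg (weight_nonneg f n) (norm_nonneg _))

/-- Up to an error with bounded partial sums, `|c_k|` is `1/(2πk)` times the modulus of the jump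
sum, so `κ` is the logarithmic mean of that modulus divided by `2π`. Without a jump positivity of
`κ` would fail. -/
theorem exists_tendsto_sum_norm_coeff (hsum : Summable fun j : jumpSet f => |jump f j|)
    {D : ℝ} (hD : ∀ N : ℕ, ∑ ν ∈ Finset.Icc 1 N, ‖smoothCoeff f ν‖ ≤ D)
    (hx : ∀ x ∈ jumpSet f, ∃ q : ℚ, x = q * (2 * Real.pi)) (hne : (jumpSet f).Nonempty) :
    ∃ κ : ℝ, 0 < κ ∧
      Tendsto (fun n : ℕ => (∑ k ∈ Finset.Icc 1 n, ‖coeff f k‖) / harmonicSum n) atTop (𝓝 κ) := by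
  obtain ⟨m, hm⟩ := exists_hasLogMean_norm_tsum (x := fun j : jumpSet f => (j : ℝ)) hsum
    fun j => hx j j.2
  obtain ⟨j₀, hj₀⟩ := hne
  have hmpos : 0 < m := (abs_pos.2 hj₀.2).trans_le
    (abs_jump_le_logMean hsum Subtype.val_injective (fun j => j.2.1) hm ⟨j₀, hj₀⟩)
  refine ⟨1 / (2 * Real.pi) * m, by positivity, ?_⟩
  set φ : ℕ → ℝ := fun k =>
    ‖∑' j : jumpSet f, (jump f j : ℂ) * Complex.exp (-((j : ℝ) * Complex.I)) ^ k‖ with hφ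
  have hclose : ∀ k : ℕ, k ≠ 0 →
      |‖coeff f k‖ - 1 / (2 * Real.pi) * ((k : ℝ)⁻¹ * φ k)| ≤ ‖smoothCoeff f k‖ := by
    intro k hk
    have e : ∀ j : jumpSet f, (jump f j : ℂ) * Complex.exp (-(Complex.I * ((k : ℤ) : ℂ) * (j : ℝ))) =
        (jump f j : ℂ) * Complex.exp (-((j : ℝ) * Complex.I)) ^ k := fun j => by
      rw [← Complex.exp_nat_mul]
      congr 2
      push_cast; ring
    have h1 : 1 / (2 * Real.pi) * ((k : ℝ)⁻¹ * φ k) = ‖(∑' j : jumpSet f, (jump f j : ℂ) *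
        Complex.exp (-(Complex.I * ((k : ℤ) : ℂ) * (j : ℝ)))) /
          (2 * Real.pi * Complex.I * ((k : ℤ) : ℂ))‖ := by
      simp_rw [e]
      rw [norm_div, norm_mul, norm_mul, norm_mul, Complex.norm_I, Complex.norm_ofNat,
        Complex.norm_real, Real.norm_of_nonneg Real.pi_pos.le, Int.cast_natCast,
        Complex.norm_natCast]
      change 1 / (2 * Real.pi) * ((k : ℝ)⁻¹ * φ k) = φ k / (2 * Real.pi * 1 * k)
      generalize φ k = y
      field_simp
    rw [h1]
    exact abs_norm_sub_norm_le _ _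
  have hdiff : Tendsto (fun n : ℕ => (∑ k ∈ Finset.Icc 1 n, ‖coeff f k‖) / harmonicSum n -
      1 / (2 * Real.pi) * ((harmonicSum n)⁻¹ • ∑ k ∈ Finset.Icc 1 n, (k : ℝ)⁻¹ • φ k)) atTop (𝓝 0) := by
    have h0 := (tendsto_inv_atTop_zero.comp tendsto_harmonicSum_atTop).mul_const D
    rw [zero_mul] at h0
    refine squeeze_zero_norm (fun n => ?_) h0
    have e : (∑ k ∈ Finset.Icc 1 n, ‖coeff f k‖) / harmonicSum n -
        1 / (2 * Real.pi) * ((harmonicSum n)⁻¹ • ∑ k ∈ Finset.Icc 1 n, (k : ℝ)⁻¹ • φ k) =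
        (harmonicSum n)⁻¹ * ∑ k ∈ Finset.Icc 1 n,
          (‖coeff f k‖ - 1 / (2 * Real.pi) * ((k : ℝ)⁻¹ * φ k)) := by
      rw [Finset.sum_sub_distrib, ← Finset.mul_sum]
      simp only [smul_eq_mul]
      ring
    rw [e, norm_mul, Real.norm_of_nonneg (inv_nonneg.2 (harmonicSum_nonneg n))]
    refine mul_le_mul_of_nonneg_left (le_trans ?_ (hD n)) (inv_nonneg.2 (harmonicSum_nonneg n))
    refine (norm_sum_le _ _).trans (Finset.sum_le_sum fun k hk => hclose k ?_)
    have := (Finset.mem_Icc.1 hk).1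
    omega
  have := hdiff.add (hm.const_mul (1 / (2 * Real.pi)))
  rw [zero_add] at this
  exact this.congr fun n => by simp only [sub_add_cancel]

/-- The numerator is asymptotic to `(κ/2) H_n²` and the normalization `log n · G(n)` to `κ H_n²`;
the unknown `κ` cancels. -/
theorem tendsto_weighted_harmonicSum {κ : ℝ} (hκ : 0 < κ)
    (h : Tendsto (fun n : ℕ => (∑ k ∈ Finset.Icc 1 n, ‖coeff f k‖) / harmonicSum n) atTop (𝓝 κ)) :
    Tendsto (fun n => ∑ k ∈ Finset.Icc 1 n, weight f n * ‖coeff f k‖ * harmonicSum k) atTop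
      (𝓝 (1 / 2)) := by
  have h1 := tendsto_sum_mul_harmonicSum_div h
  have h2 : Tendsto (fun n => coeffSum f n / harmonicSum n) atTop (𝓝 κ) := by
    have := (((tendsto_inv_atTop_zero.comp tendsto_harmonicSum_atTop).const_mul ‖coeff f 0‖)).add h
    rw [mul_zero, zero_add] at this
    refine this.congr fun n => ?_
    rw [coeffSum_eq, add_div]
    rfl
  have h3 : Tendsto (fun n : ℕ => (Real.log n / harmonicSum n) * (coeffSum f n / harmonicSum n))
      atTop (𝓝 κ) := by
    have := (tendsto_harmonicSum_div_log.inv₀ one_ne_zero).mul h2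
    rw [inv_one, one_mul] at this
    exact this.congr fun n => by rw [inv_div]
  have h4 := h1.div h3 hκ.ne'
  rw [show κ / 2 / κ = 1 / 2 by field_simp] at h4
  refine h4.congr' ?_
  filter_upwards [tendsto_harmonicSum_atTop.eventually_gt_atTop 0] with n hn
  simp_rw [mul_assoc]
  rw [← Finset.mul_sum, weight, Pi.div_apply]
  generalize ∑ k ∈ Finset.Icc 1 n, ‖coeff f k‖ * harmonicSum k = S
  rw [div_mul_div_comm, ← sq, div_div_div_cancel_right₀ (by positivity)]
  ring

end ConjugateSums

/-! ### Estimates for the spikes -/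

section Spikes

variable {f : ℝ → ℝ}

theorem tendsto_inv_log_mul (B : ℝ) :
    Tendsto (fun n : ℕ => (Real.log n)⁻¹ * B) atTop (𝓝 0) := by
  simpa using (tendsto_inv_atTop_zero.comp tendsto_log_nat).mul_const B

theorem inv_log_nonneg (n : ℕ) : 0 ≤ (Real.log n)⁻¹ := inv_nonneg.2 (Real.log_natCast_nonneg n)

theorem weight_mul_nonneg (f : ℝ → ℝ) (n k : ℕ) : 0 ≤ weight f n * ‖coeff f k‖ :=
  mul_nonneg (weight_nonneg f n) (norm_nonneg _)

theorem sum_weight_mul_const_le (f : ℝ → ℝ) (n : ℕ) {B : ℝ} (hB : 0 ≤ B) :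
    ∑ k ∈ Finset.Icc 1 n, weight f n * ‖coeff f k‖ * B ≤ (Real.log n)⁻¹ * B := by
  rw [← Finset.sum_mul]
  exact mul_le_mul_of_nonneg_right (sum_weight_le f n) hB

/-- A weighted mean of functions of variation at most `B` has variation at most `B / log n`. -/
theorem eVariationOn_weighted_le (f : ℝ → ℝ) (n : ℕ) (g : ℕ → ℝ → ℝ) {s : Set ℝ} {B : ℝ} (hB : 0 ≤ B)
    (hg : ∀ k, eVariationOn (g k) s ≤ ENNReal.ofReal B) :
    eVariationOn (fun x => ∑ k ∈ Finset.Icc 1 n, (weight f n * ‖coeff f k‖) * g k x) s ≤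
      ENNReal.ofReal ((Real.log n)⁻¹ * B) :=
  (eVariationOn_weighted_sum_le _ _ (fun k _ => weight_mul_nonneg f n k) g s (fun _ => B)
    (fun _ _ => hB) fun k _ => hg k).trans
      (ENNReal.ofReal_le_ofReal (sum_weight_mul_const_le f n hB))

theorem abs_weighted_le (f : ℝ → ℝ) (n : ℕ) (c : ℕ → ℝ) {B : ℝ} (hc : ∀ k, |c k| ≤ B) :
    |∑ k ∈ Finset.Icc 1 n, (weight f n * ‖coeff f k‖) * c k| ≤ (Real.log n)⁻¹ * B := by
  refine (Finset.abs_sum_le_sum_abs _ _).trans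
    (le_trans ?_ (sum_weight_mul_const_le f n ((abs_nonneg _).trans (hc 0))))
  refine Finset.sum_le_sum fun k _ => ?_
  rw [abs_mul, abs_of_nonneg (weight_mul_nonneg f n k)]
  exact mul_le_mul_of_nonneg_left (hc k) (weight_mul_nonneg f n k)

/-- The sum is the height of the spike, which tends to `1/2` when `f` has a jump. The factor `2`
counts the two sides of the peak, so the bound then tends to `1`. -/
theorem eVariationOn_spike_le {B : ℝ} (hB : ∀ k, |cosSum k Real.pi| ≤ B) {x : ℝ}
    (hx : x ∈ Ioo 0 (2 * Real.pi)) (n : ℕ) :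
    eVariationOn (fun t => spike f n (t - x)) (Icc 0 (2 * Real.pi)) ≤
      ENNReal.ofReal (2 * (∑ k ∈ Finset.Icc 1 n, weight f n * ‖coeff f k‖ * harmonicSum k) +
        (Real.log n)⁻¹ * (2 * (B + Real.pi))) := by
  have hpi := Real.pi_pos
  have hB0 : 0 ≤ B := (abs_nonneg _).trans (hB 0)
  refine (eVariationOn_weighted_sum_le (Finset.Icc 1 n) (fun k => weight f n * ‖coeff f k‖)
    (fun k _ => weight_mul_nonneg f n k) (fun k t => cosSum k (t - x)) _
    (fun k => 2 * harmonicSum k + 2 * (B + Real.pi)) (fun k _ => ?_) fun k _ => ?_).trans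
      (ENNReal.ofReal_le_ofReal ?_)
  · have := harmonicSum_nonneg k
    positivity
  · refine (eVariationOn_cosSum_sub hx k).trans (ENNReal.ofReal_le_ofReal ?_)
    linarith [hB k]
  · have h := sum_weight_mul_const_le f n (B := 2 * (B + Real.pi)) (by positivity)
    simp_rw [mul_add (weight f n * _), Finset.sum_add_distrib]
    refine add_le_add (le_of_eq ?_) h
    rw [Finset.mul_sum]
    exact Finset.sum_congr rfl fun k _ => by ring

theorem abs_spike_le (n : ℕ) (t : ℝ) : |spike f n t| ≤ (Real.log n)⁻¹ * harmonicSum n := by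
  refine (Finset.abs_sum_le_sum_abs _ _).trans (le_trans ?_ (weighted_harmonicSum_le f n))
  refine Finset.sum_le_sum fun k _ => ?_
  rw [abs_mul, abs_of_nonneg (weight_mul_nonneg f n k)]
  exact mul_le_mul_of_nonneg_left (abs_cosSum_le k t) (weight_mul_nonneg f n k)

theorem eventually_inv_log_mul_harmonicSum_le :
    ∀ᶠ n : ℕ in atTop, (Real.log n)⁻¹ * harmonicSum n ≤ 2 := by
  filter_upwards [(tendsto_order.1 tendsto_harmonicSum_div_log).2 2 one_lt_two] with n hn
  rw [inv_mul_eq_div]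
  exact hn.le

theorem tendsto_spike_zero {t : ℝ} (h0 : t ≠ 0) (h1 : -(2 * Real.pi) < t) (h2 : t < 2 * Real.pi) :
    Tendsto (fun n => spike f n t) atTop (𝓝 0) := by
  obtain ⟨B, hB⟩ := exists_abs_cosSum_le (exp_mul_I_ne_one h0 h1 h2)
  exact squeeze_zero_norm (fun n => abs_weighted_le f n (fun k => cosSum k t) hB)
    (tendsto_inv_log_mul B)

end Spikes

/-! ### Pointwise limit, lower bound and upper bound -/

section Limits

variable {f : ℝ → ℝ}

/-- Only a spike centred at `x` survives, with height tending to `1/2`; all other spikes and the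
remainder are `O(1/log n)` at `x`. Spikes are eventually bounded by `2`, so dominated convergence
applies to the sum over jumps. -/
theorem tendsto_Yseq (hsum : Summable fun j : jumpSet f => |jump f j|) {D : ℝ}
    (hD : ∀ N : ℕ, ∑ ν ∈ Finset.Icc 1 N, ‖smoothCoeff f ν‖ ≤ D)
    (hx : ∀ x ∈ jumpSet f, ∃ q : ℚ, x = q * (2 * Real.pi)) {x : ℝ} (hx0 : x ∈ Ioo 0 (2 * Real.pi)) :
    Tendsto (fun n => Yseq f n x) atTop (𝓝 ((jump f x / (2 * Real.pi) : ℝ) : ℂ)) := by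
  classical
  simp_rw [Yseq_eq hsum]
  refine (Complex.continuous_ofReal.tendsto _).comp ?_
  have hR : Tendsto (fun n => spikeRemainder f n x) atTop (𝓝 0) :=
    squeeze_zero_norm (fun n => abs_weighted_le f n (fun k => smoothConj f k x)
      fun k => abs_smoothConj_le f hD k x) (tendsto_inv_log_mul (2 * D))
  have hlim : ∀ j : jumpSet f, Tendsto (fun n => 1 / Real.pi * jump f j * spike f n (x - j)) atTop
      (𝓝 (if x = j then jump f j / (2 * Real.pi) else 0)) := fun j => by
    split_ifs with h
    · obtain ⟨κ, hκ, hlim⟩ := exists_tendsto_sum_norm_coeff hsum hD hx ⟨j, j.2⟩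
      have h1 := (tendsto_weighted_harmonicSum hκ hlim).const_mul (1 / Real.pi * jump f j)
      rw [show 1 / Real.pi * jump f j * (1 / 2) = jump f j / (2 * Real.pi) by
        field_simp] at h1
      refine h1.congr fun n => ?_
      rw [spike, h, sub_self]
      simp_rw [cosSum_zero_right]
    · have h1 := (tendsto_spike_zero (f := f) (sub_ne_zero.2 h) (by linarith [hx0.1, j.2.1.2])
        (by linarith [hx0.2, j.2.1.1])).const_mul (1 / Real.pi * jump f j)
      rwa [mul_zero] at h1
  have hdom := tendsto_tsum_of_dominated_convergence (bound := fun j : jumpSet f => |jump f j| * 2)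
    (hsum.mul_right 2) hlim (by
      filter_upwards [eventually_inv_log_mul_harmonicSum_le] with n hn j
      rw [Real.norm_eq_abs, abs_mul, abs_mul]
      refine mul_le_mul (mul_le_of_le_one_left (abs_nonneg _) ?_) ((abs_spike_le n _).trans hn)
        (abs_nonneg _) (abs_nonneg _)
      rw [abs_of_nonneg (by positivity), div_le_one Real.pi_pos]
      linarith [Real.pi_gt_three])
  have hval : ∑' j : jumpSet f, (if x = j then jump f j / (2 * Real.pi) else 0) =
      jump f x / (2 * Real.pi) := by
    by_cases h : x ∈ jumpSet f
    · rw [tsum_eq_single ⟨x, h⟩ fun j hj => if_neg fun e => hj (Subtype.ext e.symm), if_pos rfl]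
    · have h0 : jump f x = 0 := by
        by_contra hne
        exact h ⟨hx0, hne⟩
      rw [h0, zero_div]
      exact (tsum_congr fun j : jumpSet f => if_neg fun (e : x = j) => h (e ▸ j.2)).trans tsum_zero
  rw [hval] at hdom
  have := hdom.sub hR
  rwa [sub_zero] at this

theorem summable_jump_inter (hsum : Summable fun j : jumpSet f => |jump f j|) (s : Set ℝ) :
    Summable fun x : ↥(jumpSet f ∩ s) => |jump f x| :=
  hsum.comp_injective (i := inclusion (inter_subset_left (s := jumpSet f) (t := s)))
    (inclusion_injective _)

theorem ofReal_tsum_jump_le_eVariationOn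
    (hsum : Summable fun j : jumpSet f => |jump f j|) (hd : HasBVDeriv f) (a b : ℝ) :
    ENNReal.ofReal (1 / Real.pi * ∑' x : ↥(jumpSet f ∩ Ioo a b), |jump f x|) ≤
      eVariationOn (fun x => ((jump f x / (2 * Real.pi) : ℝ) : ℂ)) (Ioo a b) := by
  obtain ⟨C, hC, hdiff, -⟩ := hd
  set h : ℝ → ℂ := fun x => ((jump f x / (2 * Real.pi) : ℝ) : ℂ) with hh
  have hzero : ∀ x ∉ C, h x = 0 := fun x hx => by
    simp [hh, jump_eq_zero_of_continuousAt (hdiff x hx).continuousAt]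
  have hdense : Dense Cᶜ := hC.dense_compl ℝ
  have hloc : ∀ z c z', z < c → c < z' → ENNReal.ofReal (1 / Real.pi * |jump f c|) ≤
      eVariationOn h (Ioo z z') := by
    intro z c z' hz hz'
    obtain ⟨z₁, hz₁, hzz₁, hz₁c⟩ := hdense.exists_between hz
    obtain ⟨z₂, hz₂, hcz₂, hz₂z⟩ := hdense.exists_between hz'
    -- Between two neighbouring zeros of `h` the function rises to its value at `c` and falls back,
    -- so `|J|/(2π)` is counted twice.
    have h1 : eVariationOn h {z₁, c} + eVariationOn h {c, z₂} ≤
        eVariationOn h ({z₁, c} ∪ {c, z₂}) := by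
      refine eVariationOn.add_le_union h ?_
      rintro x (rfl | rfl) y (rfl | rfl) <;> linarith
    rw [eVariationOn.pair, eVariationOn.pair, hzero z₁ hz₁, hzero z₂ hz₂,
      edist_comm 0 (h c), edist_zero_right, ← two_mul] at h1
    refine le_trans (le_trans (le_of_eq ?_) h1) (eVariationOn.mono h ?_)
    · rw [← ofReal_norm, Complex.norm_real, Real.norm_eq_abs, abs_div,
        abs_of_pos Real.two_pi_pos, ← ENNReal.ofReal_ofNat 2, ← ENNReal.ofReal_mul two_pos.le]
      congr 1
      have := Real.pi_ne_zero
      field_simp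
    · rintro x ((rfl | rfl) | (rfl | rfl))
      · exact ⟨hzz₁, hz₁c.trans hz'⟩
      · exact ⟨hz, hz'⟩
      · exact ⟨hz, hz'⟩
      · exact ⟨hz.trans hcz₂, hz₂z⟩
  have hs : Summable fun x : ↥(jumpSet f ∩ Ioo a b) => 1 / Real.pi * |jump f x| :=
    (summable_jump_inter hsum _).mul_left _
  rw [← tsum_mul_left, ENNReal.ofReal_tsum_of_nonneg (fun _ => by positivity) hs,
    ENNReal.tsum_eq_iSup_sum]
  refine iSup_le fun F => ?_
  have := sum_le_eVariationOn_Ioo hloc (F.map (Function.Embedding.subtype _)) a b (by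
    intro c hc
    obtain ⟨j, -, rfl⟩ := Finset.mem_map.1 hc
    exact j.2.2)
  rwa [Finset.sum_map] at this

/-- A jump inside `(a, b)` contributes the variation of a whole spike, asymptotically at most `1`. A
jump outside contributes only the variation of a spike away from its centre, which tends to `0`. -/
theorem exists_tendsto_eVariationOn_le (hsum : Summable fun j : jumpSet f => |jump f j|) {D D' : ℝ}
    (hD : ∀ N : ℕ, ∑ ν ∈ Finset.Icc 1 N, ‖smoothCoeff f ν‖ ≤ D)
    (hD' : ∀ N : ℕ, ∑ ν ∈ Finset.Icc 1 N, (ν : ℝ) ^ 2 * ‖smoothCoeff f ν‖ ^ 2 ≤ D')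
    (hx : ∀ x ∈ jumpSet f, ∃ q : ℚ, x = q * (2 * Real.pi)) {a b : ℝ} (ha : 0 ≤ a) (hab : a < b)
    (hb : b ≤ 2 * Real.pi) (hja : jump f a = 0) (hjb : jump f b = 0) :
    ∃ v : ℕ → ENNReal, (∀ n, eVariationOn (Yseq f n) (Ioo a b) ≤ v n) ∧ Tendsto v atTop
      (𝓝 (ENNReal.ofReal (1 / Real.pi * ∑' x : ↥(jumpSet f ∩ Ioo a b), |jump f x|))) := by
  classical
  have hpi := Real.pi_pos
  have hD0 : 0 ≤ D' := by simpa using hD' 0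
  obtain ⟨Bπ, hBπ⟩ := exists_abs_cosSum_pi_le
  have hBπ0 : 0 ≤ Bπ := (abs_nonneg _).trans (hBπ 0)
  have hsub : Ioo a b ⊆ Icc 0 (2 * Real.pi) := fun x hx => ⟨ha.trans hx.1.le, hx.2.le.trans hb⟩
  set u : ℕ → ℝ := fun n =>
    2 * (∑ k ∈ Finset.Icc 1 n, weight f n * ‖coeff f k‖ * harmonicSum k) +
      (Real.log n)⁻¹ * (2 * (Bπ + Real.pi)) with hu
  have hu0 : ∀ n, 0 ≤ u n := fun n => by
    have h1 : 0 ≤ ∑ k ∈ Finset.Icc 1 n, weight f n * ‖coeff f k‖ * harmonicSum k :=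
      Finset.sum_nonneg fun k _ => mul_nonneg (weight_mul_nonneg f n k) (harmonicSum_nonneg k)
    have h2 := inv_log_nonneg n
    simp only [hu]
    positivity
  -- The weighted sum is eventually at most `2`, and the other term at most `1`.
  have hub : ∀ᶠ n in atTop, u n ≤ 5 := by
    filter_upwards [eventually_inv_log_mul_harmonicSum_le,
      (tendsto_order.1 (tendsto_inv_log_mul (2 * (Bπ + Real.pi)))).2 1 one_pos] with n hn hn'
    have := weighted_harmonicSum_le f n
    simp only [hu]
    linarith
  have hfar : ∀ j : jumpSet f, ∃ B : ℝ, 0 ≤ B ∧ ((j : ℝ) ∉ Ioo a b → ∀ n,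
      eVariationOn (fun t => spike f n (t - j)) (Ioo a b) ≤
        ENNReal.ofReal ((Real.log n)⁻¹ * B)) := fun j => by
    by_cases hj : (j : ℝ) ∈ Ioo a b
    · exact ⟨0, le_rfl, fun h => absurd hj h⟩
    -- As the endpoints are not jumps, a jump outside the open interval is at positive distance from
    -- the closed one.
    · have hj' : (j : ℝ) ∉ Icc a b := fun h => hj
        ⟨lt_of_le_of_ne h.1 fun e => j.2.2 (e ▸ hja), lt_of_le_of_ne h.2 fun e => j.2.2 (e ▸ hjb)⟩
      obtain ⟨B, hB0, hB⟩ := exists_eVariationOn_cosSum_sub_le j.2.1 ha hb hab.le hj'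
      exact ⟨B, hB0, fun _ n => eVariationOn_weighted_le f n (fun k t => cosSum k (t - j)) hB0
        fun k => (eVariationOn.mono _ Ioo_subset_Icc_self).trans (hB k)⟩
  choose B hB0 hB using hfar
  -- The constants `B j` need not be bounded as the jumps approach `a` or `b`. The minimum with `u
  -- n` retains a bound uniform in `j`, which dominated convergence requires.
  set U : ℕ → jumpSet f → ℝ := fun n j =>
    if (j : ℝ) ∈ Ioo a b then u n else min (u n) ((Real.log n)⁻¹ * B j) with hU
  have hU0 : ∀ n j, 0 ≤ U n j := fun n j => by
    simp only [hU]
    split_ifs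
    · exact hu0 n
    · exact le_min (hu0 n) (mul_nonneg (inv_log_nonneg n) (hB0 j))
  have hUu : ∀ n j, U n j ≤ u n := fun n j => by
    simp only [hU]
    split_ifs
    · exact le_rfl
    · exact min_le_left _ _
  have hV : ∀ n (j : jumpSet f), eVariationOn (fun t => spike f n (t - j)) (Ioo a b) ≤
      ENNReal.ofReal (U n j) := fun n j => by
    have h1 := (eVariationOn.mono (fun t => spike f n (t - j)) hsub).trans
      (eVariationOn_spike_le hBπ j.2.1 n)
    simp only [hU]
    split_ifs with hj
    · exact h1
    · rcases min_choice (u n) ((Real.log n)⁻¹ * B j) with e | e <;> rw [e]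
      · exact h1
      · exact hB j hj n
  set R : ℝ := Real.pi + 4 * Real.pi * D' with hR
  have hR0 : 0 ≤ R := by positivity
  have hVR : ∀ n, eVariationOn (spikeRemainder f n) (Ioo a b) ≤
      ENNReal.ofReal ((Real.log n)⁻¹ * R) := fun n =>
    eVariationOn_weighted_le f n (smoothConj f) hR0 fun k =>
      (eVariationOn.mono _ hsub).trans (eVariationOn_smoothConj_le f hD' k)
  have hsumU : ∀ n, Summable fun j : jumpSet f => 1 / Real.pi * |jump f j| * U n j := fun n => by
    refine Summable.of_nonneg_of_le (fun j => mul_nonneg (by positivity) (hU0 n j))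
      (fun j => mul_le_mul_of_nonneg_left (hUu n j) (by positivity)) ?_
    exact (hsum.mul_left _).mul_right _
  refine ⟨fun n => ENNReal.ofReal (∑' j : jumpSet f, 1 / Real.pi * |jump f j| * U n j) +
    ENNReal.ofReal ((Real.log n)⁻¹ * R), fun n => ?_, ?_⟩
  · have h1 : eVariationOn (Yseq f n) (Ioo a b) ≤
        eVariationOn (fun x => ∑' j : jumpSet f, 1 / Real.pi * jump f j * spike f n (x - j))
          (Ioo a b) + eVariationOn (spikeRemainder f n) (Ioo a b) := by
      have := eVariationOn_le_sum (h := Yseq f n) (s := Ioo a b) (w := 1)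
        (g := ![fun x => ∑' j : jumpSet f, 1 / Real.pi * jump f j * spike f n (x - j),
          spikeRemainder f n]) Finset.univ fun x _ y _ => by
          rw [Yseq_eq hsum, Yseq_eq hsum, Complex.isometry_ofReal.edist_eq]
          simp only [Fin.sum_univ_two, Pi.one_apply, one_mul, Matrix.cons_val_zero,
            Matrix.cons_val_one]
          rw [sub_eq_add_neg, sub_eq_add_neg]
          refine (edist_add_add_le _ _ _ _).trans ?_
          rw [edist_neg_neg]
      simpa using this
    refine h1.trans (add_le_add ?_ (hVR n))
    have hs : ∀ x, Summable fun j : jumpSet f => 1 / Real.pi * jump f j * spike f n (x - j) :=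
      fun x => by
        simp_rw [mul_assoc]
        exact (summable_jump_mul_spike hsum n x).mul_left _
    refine (eVariationOn_le_tsum (g := fun (j : jumpSet f) t => spike f n (t - j))
      (w := fun j => ENNReal.ofReal (1 / Real.pi * |jump f j|)) fun x _ y _ => ?_).trans ?_
    · rw [edist_eq_enorm_sub, ← (hs x).tsum_sub (hs y)]
      refine (enorm_tsum_le_tsum_enorm).trans (ENNReal.tsum_le_tsum fun j => ?_)
      rw [← mul_sub, enorm_mul, edist_eq_enorm_sub, Real.enorm_eq_ofReal_abs (1 / Real.pi * _),
        abs_mul, abs_of_pos (by positivity : 0 < 1 / Real.pi)]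
    · rw [ENNReal.ofReal_tsum_of_nonneg (fun j => mul_nonneg (by positivity) (hU0 n j)) (hsumU n)]
      refine ENNReal.tsum_le_tsum fun j => ?_
      rw [ENNReal.ofReal_mul (p := 1 / Real.pi * |jump f j|) (by positivity)]
      exact mul_le_mul' le_rfl (hV n j)
  · have hlim : ∀ j : jumpSet f, Tendsto (fun n => 1 / Real.pi * |jump f j| * U n j) atTop
        (𝓝 (1 / Real.pi * |jump f j| * if (j : ℝ) ∈ Ioo a b then 1 else 0)) := fun j => by
      refine Tendsto.const_mul _ ?_
      simp only [hU]
      split_ifs with hj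
      · obtain ⟨κ, hκ, hlim⟩ := exists_tendsto_sum_norm_coeff hsum hD hx ⟨j, j.2⟩
        have := ((tendsto_weighted_harmonicSum hκ hlim).const_mul 2).add
          (tendsto_inv_log_mul (2 * (Bπ + Real.pi)))
        rwa [add_zero, mul_one_div_cancel two_ne_zero] at this
      · exact squeeze_zero (fun n => le_min (hu0 n) (mul_nonneg (inv_log_nonneg n) (hB0 j)))
          (fun n => min_le_right _ _) (tendsto_inv_log_mul (B j))
    have hdom := tendsto_tsum_of_dominated_convergence
      (bound := fun j : jumpSet f => 1 / Real.pi * |jump f j| * 5)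
      ((hsum.mul_left _).mul_right _) hlim (by
        filter_upwards [hub] with n hn j
        rw [Real.norm_of_nonneg (mul_nonneg (by positivity) (hU0 n j))]
        exact mul_le_mul_of_nonneg_left ((hUu n j).trans hn) (by positivity))
    have hval : ∑' j : jumpSet f, (1 / Real.pi * |jump f j| * if (j : ℝ) ∈ Ioo a b then 1 else 0) =
        1 / Real.pi * ∑' x : ↥(jumpSet f ∩ Ioo a b), |jump f x| := by
      simp_rw [mul_assoc, tsum_mul_left]
      congr 1
      rw [tsum_subtype (jumpSet f) (fun x => |jump f x| * if x ∈ Ioo a b then 1 else 0),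
        tsum_subtype (jumpSet f ∩ Ioo a b) (fun x => |jump f x|), ← indicator_indicator]
      refine tsum_congr fun x => ?_
      congr 1
      ext y
      simp [indicator]
    rw [hval] at hdom
    have h1 := (ENNReal.tendsto_ofReal hdom).add (ENNReal.tendsto_ofReal (tendsto_inv_log_mul R))
    rwa [ENNReal.ofReal_zero, add_zero] at h1

end Limits

theorem lemma2p2 :
    ∃ K : ℝ, 0 < K ∧
      ∀ f : ℝ → ℝ,
        Function.Periodic f (2 * Real.pi) →
        BoundedVariationOn f (Set.Icc 0 (2 * Real.pi)) →
        HasBVDeriv f →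
        jump f 0 = 0 → jump f Real.pi = 0 → jump f (2 * Real.pi) = 0 →
        (∀ x ∈ jumpSet f, ∃ q : ℚ, x = q * (2 * Real.pi)) →
        ∀ a b : ℝ, 0 ≤ a → a < b → b ≤ 2 * Real.pi →
          jump f a = 0 → jump f b = 0 →
          Summable (fun x : ↥(jumpSet f ∩ Set.Ioo a b) => |jump f x|) ∧
          Filter.Tendsto (fun n : ℕ => eVariationOn (Yseq f n) (Set.Ioo a b)) Filter.atTop
            (𝓝 (ENNReal.ofReal
              (K * (1 / Real.pi) * ∑' x : ↥(jumpSet f ∩ Set.Ioo a b), |jump f x|))) := by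
  refine ⟨1, one_pos, fun f hf hbv hd h0 _ _ hx a b ha hab hb hja hjb => ?_⟩
  have hsum := summable_jump hf hbv
  obtain ⟨D, hD⟩ := exists_sum_norm_smoothCoeff_le hf hbv hd h0
  obtain ⟨D', hD'⟩ := exists_sum_sq_smoothCoeff_le hf hbv hd h0
  refine ⟨summable_jump_inter hsum _, ?_⟩
  rw [one_mul]
  obtain ⟨v, hv, hvlim⟩ := exists_tendsto_eVariationOn_le hsum hD hD' hx ha hab hb hja hjb
  -- Below the limit, lower semicontinuity of the variation along the pointwise convergence of
  -- `Y_n`; above it, the majorant `v`.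
  refine tendsto_order.2 ⟨fun w hw => ?_, fun w hw => ?_⟩
  · refine eVariationOn.lowerSemicontinuous_aux (fun x hxab => ?_)
      (hw.trans_le (ofReal_tsum_jump_le_eVariationOn hsum hd a b))
    exact tendsto_Yseq hsum hD hx ⟨ha.trans_lt hxab.1, hxab.2.trans_le hb⟩
  · filter_upwards [(tendsto_order.1 hvlim).2 w hw] with n hn
    exact (hv n).trans_lt hn
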